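/- Let $K$ be an ordered field and let $n\ge 2$ be even. Put $GL_+(n,K)=\{g\in GL(n,K):\det g>0\}$, let $PGL_+(n,K)$ be its quotient by all scalar matrices it contains, and $P_+GL_+(n,K)$ its quotient by the scalar matrices $\lambda I$ with $\lambda>0$. These groups act on $\mathbf P=(K^n\setminus\{0\})/K^\times$ and on $\mathbf P_+=(K^n\setminus\{0\})/K_{>0}$, respectively. Let $X$ (resp. $X_+$) be the simplicial complex with vertex set $\mathbf P$ (resp. $\mathbf P_+$) whose simplices are spanned by the generic finite sets of points, i.e. those for which any at most $n$ of the points are represented by linearly independent vectors. For a group $G$ acting on an acyclic simplicial complex $Y$, with (alternating) simplicial chain complex $C_*=C_*Y$ and boundaries $B_n=\partial C_{n+1}$, let $U_n(Y)=(C_n/B_n)_G$ (coinvariants) and let $\tau^n_{G,Y}\in H^n(G,U_n(Y))$ be the class of the cocycle $P_n\to C_n\to U_n(Y)$, where $P_*\to C_*$ is an augmentation-preserving $G$-chain map from a projective resolution $P_*$ of the trivial $G$-module $\mathbf Z$, and $C_n\to U_n(Y)$ is the quotient map. Put $U=U_n(X)$, $U_+=U_n(X_+)$, $eu=\tau^n_{PGL_+(n,K),X}\in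 H^n(PGL_+(n,K),U)$ and $eu_+=\tau^n_{P_+GL_+(n,K),X_+}\in H^n(P_+GL_+(n,K),U_+)$. Let $e_1,\dots,e_n$ be the standard basis of $K^n$. Then there is an isomorphism $U\cong\mathbf Z$ sending to $1$ the class of the simplex $([e_1],\dots,[e_n],[e_1+\dots+e_n])$, and $U_+$ is a free abelian group with basis $a^+$ $(0\le a\le n/2)$, where $a^+$ is the class of the simplex $([e_1],\dots,[e_n],[e_1+\dots+e_a-e_{a+1}-\dots-e_n])$. Regard $eu$ as a class in $H^n(PGL_+(n,K),\mathbf Z)$ through this isomorphism, and let $eu_a\in H^n(P_+GL_+(n,K),\mathbf Z)$ be the image of $eu_+$ under the $a$-th coordinate map $U_+\to\mathbf Z$ of this basis. If $\phi\colon P_+GL_+(n,K)\to PGL_+(n,K)$ is the natural projection, then $$\phi^*eu=\sum_{a=0}^{n/2}(-1)^a\,eu_a\qquad\text{in }H^n(P_+GL_+(n,K),\mathbf Z).$$ -/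

import Mathlib

open CategoryTheory

universe u

namespace TautologicalClass

noncomputable section

/-! ### Simplicial complexes with a group action and their chain complexes -/

/-- An abstract simplicial complex with vertex set `V`, together with an action of `G` by
simplicial automorphisms. -/
structure GSimplicialComplex (G V : Type u) [Group G] [MulAction G V] extends
    AbstractSimplicialComplex V where
  smul_mem : ∀ (g : G) (s : Finset V), s ∈ faces →
    s.map (MulAction.toPerm g).toEmbedding ∈ faces

section Chains

variable {G V : Type u} [Group G] [MulAction G V]

/-- Non-degenerate ordered `d`-simplices: tuples `(v₀, …, v_d)` of pairwise distinct vertices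
that span a simplex. -/
structure OrderedSimplex (X : GSimplicialComplex G V) (d : ℕ) where
  vertex : Fin (d + 1) ↪ V
  mem_faces : Finset.univ.map vertex ∈ X.faces

namespace OrderedSimplex

variable {X : GSimplicialComplex G V} {d : ℕ}

@[ext]
theorem ext' {σ τ : OrderedSimplex X d} (h : ∀ i, σ.vertex i = τ.vertex i) : σ = τ := by
  cases σ; cases τ
  congr
  exact DFunLike.ext _ _ h

/-- The translate `g σ`. -/
def translate (g : G) (σ : OrderedSimplex X d) : OrderedSimplex X d where
  vertex := σ.vertex.trans (MulAction.toPerm g).toEmbedding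
  mem_faces := by
    rw [← Finset.map_map]
    exact X.smul_mem g _ σ.mem_faces

/-- The tuple `(v_{t 0}, …, v_{t d})`. -/
def permute (t : Equiv.Perm (Fin (d + 1))) (σ : OrderedSimplex X d) : OrderedSimplex X d where
  vertex := t.toEmbedding.trans σ.vertex
  mem_faces := by
    rw [← Finset.map_map, Finset.map_univ_equiv]
    exact σ.mem_faces

/-- The tuple with the `i`-th vertex omitted. -/
def face (i : Fin (d + 2)) (σ : OrderedSimplex X (d + 1)) : OrderedSimplex X d where
  vertex := i.succAboveEmb.trans σ.vertex
  mem_faces := by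
    refine (X.isRelLowerSet_faces σ.mem_faces).2 ?_ (by simp)
    intro v hv
    simp only [Finset.mem_map, Finset.mem_univ, true_and] at hv ⊢
    obtain ⟨j, rfl⟩ := hv
    exact ⟨_, rfl⟩

@[simp] theorem translate_vertex (g : G) (σ : OrderedSimplex X d) (i : Fin (d + 1)) :
    (σ.translate g).vertex i = g • σ.vertex i := rfl

@[simp] theorem permute_vertex (t : Equiv.Perm (Fin (d + 1))) (σ : OrderedSimplex X d)
    (i : Fin (d + 1)) : (σ.permute t).vertex i = σ.vertex (t i) := rfl

@[simp] theorem face_vertex (i : Fin (d + 2)) (σ : OrderedSimplex X (d + 1)) (j : Fin (d + 1)) :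
    (σ.face i).vertex j = σ.vertex (i.succAbove j) := rfl

theorem translate_permute (g : G) (t : Equiv.Perm (Fin (d + 1))) (σ : OrderedSimplex X d) :
    (σ.permute t).translate g = (σ.translate g).permute t := rfl

end OrderedSimplex

variable (R : Type u) [CommRing R] (X : GSimplicialComplex G V)

/-- The ordered chain group: the free `R`-module on the non-degenerate ordered `d`-simplices. -/
abbrev OrderedChain (d : ℕ) : Type u := OrderedSimplex X d →₀ R

/-- The submodule generated by the alternation relations `t σ - sgn(t) σ`. -/
def alternation (d : ℕ) : Submodule R (OrderedChain R X d) :=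
  Submodule.span R {c | ∃ (σ : OrderedSimplex X d) (t : Equiv.Perm (Fin (d + 1))),
    c = Finsupp.single (σ.permute t) 1 -
      ((Equiv.Perm.sign t : ℤ) : R) • Finsupp.single σ 1}

/-- The simplicial (alternating) chain group `C_d X`. -/
abbrev Chain (d : ℕ) : Type u := OrderedChain R X d ⧸ alternation R X d

variable {X} in
/-- The chain `[v₀, …, v_d]`. -/
def chainOf {d : ℕ} (σ : OrderedSimplex X d) : Chain R X d :=
  (alternation R X d).mkQ (Finsupp.single σ 1)

variable {R X}

theorem chainOf_permute {d : ℕ} (σ : OrderedSimplex X d) (t : Equiv.Perm (Fin (d + 1))) :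
    chainOf R (σ.permute t) = ((Equiv.Perm.sign t : ℤ) : R) • chainOf R σ := by
  rw [chainOf, chainOf, ← map_smul, ← sub_eq_zero, ← map_sub]
  exact (Submodule.Quotient.mk_eq_zero _).2 (Submodule.subset_span ⟨σ, t, rfl⟩)

/-- Linear maps out of `C_d X` are alternating functions of ordered simplices. -/
def chainLift {d : ℕ} {M : Type*} [AddCommGroup M] [Module R M] (f : OrderedSimplex X d → M)
    (hf : ∀ σ t, f (σ.permute t) = ((Equiv.Perm.sign t : ℤ) : R) • f σ) :
    Chain R X d →ₗ[R] M :=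
  (alternation R X d).liftQ (Finsupp.linearCombination R f) (by
    rw [alternation, Submodule.span_le]
    rintro _ ⟨σ, t, rfl⟩
    simp [hf])

@[simp] theorem chainLift_chainOf {d : ℕ} {M : Type*} [AddCommGroup M] [Module R M]
    (f : OrderedSimplex X d → M)
    (hf : ∀ σ t, f (σ.permute t) = ((Equiv.Perm.sign t : ℤ) : R) • f σ) (σ : OrderedSimplex X d) :
    chainLift f hf (chainOf R σ) = f σ := by
  simp [chainLift, chainOf]

theorem chain_hom_ext {d : ℕ} {M : Type*} [AddCommGroup M] [Module R M]
    {f g : Chain R X d →ₗ[R] M} (h : ∀ σ, f (chainOf R σ) = g (chainOf R σ)) : f = g := by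
  apply Submodule.linearMap_qext
  exact Finsupp.lhom_ext' fun σ => LinearMap.ext_ring (h σ)

theorem exists_removal {d : ℕ} (t : Equiv.Perm (Fin (d + 2))) (i : Fin (d + 2)) :
    ∃ e : Equiv.Perm (Fin (d + 1)), (∀ j, t (i.succAbove j) = (t i).succAbove (e j)) ∧
      (-1 : ℤ) ^ (i : ℕ) * (Equiv.Perm.sign e : ℤ) =
        (Equiv.Perm.sign t : ℤ) * (-1) ^ (t i : ℕ) := by
  set p : Equiv.Perm (Fin (d + 2)) := (t i).cycleRange * t * i.cycleRange⁻¹ with hp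
  obtain ⟨⟨a, e⟩, hae⟩ := Equiv.Perm.decomposeFin.symm.surjective p
  have h0 : p 0 = 0 := by
    simp [hp, Equiv.Perm.mul_apply, Fin.cycleRange_symm_zero]
  have ha : a = 0 := by
    rw [← hae] at h0
    simpa using h0
  subst ha
  refine ⟨e, fun j => ?_, ?_⟩
  · have : p j.succ = (e j).succ := by rw [← hae]; simp
    apply (t i).cycleRange.injective
    rw [Fin.cycleRange_succAbove, ← this, hp]
    simp [Equiv.Perm.mul_apply]
  · have hs : Equiv.Perm.sign p = Equiv.Perm.sign e := by
      rw [← hae, Equiv.Perm.decomposeFin.symm_sign]; simp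
    rw [← hs, hp]
    simp only [map_mul, map_inv, Fin.sign_cycleRange]
    have h1 : ((-1 : ℤ) ^ (i : ℕ)) * (-1) ^ (i : ℕ) = 1 := by
      rw [← mul_pow]; simp
    simp
    linear_combination ((Equiv.Perm.sign t : ℤ) * (-1) ^ (t i : ℕ)) * h1

/-- `∂[v₀, …, v_{d+1}] = ∑ (-1)^i [v₀, …, v̂ᵢ, …, v_{d+1}]`. -/
def boundary (R : Type u) [CommRing R] (X : GSimplicialComplex G V) (d : ℕ) :
    Chain R X (d + 1) →ₗ[R] Chain R X d :=
  chainLift (fun σ => ∑ i : Fin (d + 2), (-1 : R) ^ (i : ℕ) • chainOf R (σ.face i)) (by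
    intro σ t
    rw [Finset.smul_sum]
    refine Fintype.sum_equiv t _ _ fun i => ?_
    obtain ⟨e, he, hs⟩ := exists_removal t i
    have : (σ.permute t).face i = (σ.face (t i)).permute e := by
      ext j; simp [he]
    rw [this, chainOf_permute, smul_smul, smul_smul]
    congr 1
    exact_mod_cast congrArg (Int.cast : ℤ → R) hs)

@[simp] theorem boundary_chainOf {d : ℕ} (σ : OrderedSimplex X (d + 1)) :
    boundary R X d (chainOf R σ) =
      ∑ i : Fin (d + 2), (-1 : R) ^ (i : ℕ) • chainOf R (σ.face i) :=
  chainLift_chainOf _ _ _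

theorem boundary_boundary (d : ℕ) : boundary R X d ∘ₗ boundary R X (d + 1) = 0 := by
  apply chain_hom_ext
  intro σ
  simp only [LinearMap.comp_apply, boundary_chainOf, map_sum, map_smul, Finset.smul_sum,
    LinearMap.zero_apply, smul_smul]
  rw [← Finset.sum_product']
  let P := Fin (d + 3) × Fin (d + 2)
  let S : Finset P := {ij : P | (ij.1 : ℕ) ≤ (ij.2 : ℕ)}
  rw [Finset.univ_product_univ, ← Finset.sum_add_sum_compl S, ← eq_neg_iff_add_eq_zero,
    ← Finset.sum_neg_distrib]
  let φ : ∀ ij : P, ij ∈ S → P := fun ij hij =>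
    (ij.2.succ, Fin.castLT ij.1 (lt_of_le_of_lt (Finset.mem_filter.mp hij).right (Fin.is_lt ij.2)))
  apply Finset.sum_bij φ
  · intro ij hij
    simp_rw [S, φ, Finset.compl_filter, Finset.mem_filter_univ, Fin.val_succ,
      Fin.val_castLT] at hij ⊢
    lia
  · rintro ⟨i, j⟩ hij ⟨i', j'⟩ hij' h
    rw [Prod.mk_inj]
    exact ⟨by simpa [φ, Fin.castSucc_castLT] using! congr_arg Fin.castSucc (congr_arg Prod.snd h),
      by simpa [φ] using! congr_arg Prod.fst h⟩
  · rintro ⟨i', j'⟩ hij'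
    simp_rw [S, Finset.compl_filter, Finset.mem_filter_univ, not_le] at hij'
    refine ⟨(Fin.castSucc j', i'.pred <| ?_), ?_, ?_⟩
    · rintro rfl
      simp only [Fin.val_zero, not_lt_zero] at hij'
    · simpa [S] using! Nat.le_sub_one_of_lt hij'
    · simp only [φ, Fin.castLT_castSucc, Fin.succ_pred]
  · rintro ⟨i, j⟩ hij
    have hle : (i : ℕ) ≤ j := by simpa [S] using! hij
    rw [← neg_smul]
    congr 1
    · simp only [φ, Fin.val_succ, pow_add, pow_one, Fin.val_castLT]
      ring
    · congr 1
      ext k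
      simp only [OrderedSimplex.face_vertex, φ]
      congr 1
      ext
      simp only [Fin.succAbove, Fin.lt_def]
      split_ifs <;> simp at * <;> lia

variable (R X) in
/-- Translation of chains by a group element. -/
def chainTranslate (d : ℕ) (g : G) : Chain R X d →ₗ[R] Chain R X d :=
  chainLift (fun σ => chainOf R (σ.translate g)) fun σ t => by
    rw [OrderedSimplex.translate_permute, chainOf_permute]

@[simp] theorem chainTranslate_chainOf {d : ℕ} (g : G) (σ : OrderedSimplex X d) :
    chainTranslate R X d g (chainOf R σ) = chainOf R (σ.translate g) :=
  chainLift_chainOf _ _ _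

variable (R X) in
/-- The action of `G` on `C_d X`. -/
def chainAction (d : ℕ) : Representation R G (Chain R X d) where
  toFun g := chainTranslate R X d g
  map_one' := chain_hom_ext fun σ => by
    rw [chainTranslate_chainOf]
    exact congrArg (chainOf R) (OrderedSimplex.ext' fun i => one_smul G _)
  map_mul' g h := chain_hom_ext fun σ => by
    rw [chainTranslate_chainOf, Module.End.mul_apply, chainTranslate_chainOf,
      chainTranslate_chainOf]
    exact congrArg (chainOf R) (OrderedSimplex.ext' fun i => mul_smul g h _)

@[simp] theorem chainAction_chainOf {d : ℕ} (g : G) (σ : OrderedSimplex X d) :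
    chainAction R X d g (chainOf R σ) = chainOf R (σ.translate g) :=
  chainTranslate_chainOf g σ

variable (R X) in
/-- The boundary operator as a morphism of `G`-modules. -/
def boundaryHom (d : ℕ) : Rep.of (chainAction R X (d + 1)) ⟶ Rep.of (chainAction R X d) :=
  Rep.ofHom ⟨boundary R X d, fun g => chain_hom_ext fun σ => by
    simp only [LinearMap.comp_apply, chainAction_chainOf, boundary_chainOf, map_sum, map_smul]
    rfl⟩

variable (R X) in
/-- The simplicial `G`-chain complex `C_* X`. -/
def chainComplex : ChainComplex (Rep.{u} R G) ℕ :=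
  ChainComplex.of (fun d => Rep.of (chainAction R X d)) (fun d => boundaryHom R X d) fun d => by
    refine Rep.hom_ext (Representation.IntertwiningMap.ext ?_)
    exact boundary_boundary d

theorem chainComplex_d (d : ℕ) : (chainComplex R X).d (d + 1) d = boundaryHom R X d := by
  simp [chainComplex]

variable (R X) in
/-- The augmentation `C_0 X → R`, sending every vertex to `1`. -/
def augmentation : Chain R X 0 →ₗ[R] R :=
  chainLift (fun _ => 1) fun σ t => by
    have : t = 1 := Equiv.ext fun i => Fin.ext (by lia)
    simp [this]

@[simp] theorem augmentation_chainOf (σ : OrderedSimplex X 0) :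
    augmentation R X (chainOf R σ) = 1 :=
  chainLift_chainOf _ _ _

variable (R X) in
/-- The augmentation as a morphism of `G`-modules. -/
def augmentationHom : (chainComplex R X).X 0 ⟶ Rep.trivial R G R :=
  Rep.ofHom (σ := Representation.trivial R G R) ⟨augmentation R X, fun g => chain_hom_ext fun σ => by
    simp⟩

/-! ### The star property and acyclicity -/

/-- The star property: for every finite set `Y` of vertices there is a vertex `v`
outside of `Y` which is joinable with every simplex having its vertices in `Y`. -/
def StarProperty (X : GSimplicialComplex G V) : Prop :=
  ∀ Y : Finset V, ∃ v, ∃ hv : v ∉ Y, ∀ s (hs : s ⊆ Y), s ∈ X.faces →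
    Finset.cons v s (fun h => hv (hs h)) ∈ X.faces

/-- `v` is joinable with `σ`: the vertex `v` is not in `σ` and `v * σ` is a simplex. -/
def Joinable (v : V) {d : ℕ} (σ : OrderedSimplex X d) : Prop :=
  ∃ hv : v ∉ Finset.univ.map σ.vertex, Finset.cons v (Finset.univ.map σ.vertex) hv ∈ X.faces

/-- The join `[v, v₀, …, v_d]`. -/
def join (v : V) {d : ℕ} (σ : OrderedSimplex X d) (h : Joinable v σ) :
    OrderedSimplex X (d + 1) where
  vertex := ⟨Fin.cons v σ.vertex, Fin.cons_injective_iff.2 ⟨by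
    have := h.1
    simpa using this, σ.vertex.injective⟩⟩
  mem_faces := by
    convert h.2
    ext w
    simp [Fin.exists_fin_succ, eq_comm]

theorem Joinable.permute {v : V} {d : ℕ} {σ : OrderedSimplex X d} (h : Joinable v σ)
    (t : Equiv.Perm (Fin (d + 1))) : Joinable v (σ.permute t) := by
  have : Finset.univ.map (σ.permute t).vertex = Finset.univ.map σ.vertex := by
    rw [OrderedSimplex.permute, ← Finset.map_map, Finset.map_univ_equiv]
  unfold Joinable at h ⊢
  simpa only [this] using h

theorem joinable_permute_iff {v : V} {d : ℕ} {σ : OrderedSimplex X d}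
    (t : Equiv.Perm (Fin (d + 1))) : Joinable v (σ.permute t) ↔ Joinable v σ :=
  ⟨fun h => by
    have := h.permute t⁻¹
    rwa [show (σ.permute t).permute t⁻¹ = σ from OrderedSimplex.ext' (by simp)] at this,
    fun h => h.permute t⟩

theorem join_permute {v : V} {d : ℕ} {σ : OrderedSimplex X d} (h : Joinable v σ)
    (t : Equiv.Perm (Fin (d + 1))) :
    join v (σ.permute t) (h.permute t) =
      (join v σ h).permute (Equiv.Perm.decomposeFin.symm (0, t)) := by
  ext i
  refine Fin.cases ?_ (fun j => ?_) i
  · simp [join]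
  · simp [join]

open Classical in
variable (R X) in
/-- The cone operator `σ ↦ v * σ`, extended by zero to the simplices not joinable with `v`. -/
def cone (v : V) (d : ℕ) : Chain R X d →ₗ[R] Chain R X (d + 1) :=
  chainLift (fun σ => if h : Joinable v σ then chainOf R (join v σ h) else 0) fun σ t => by
    by_cases h : Joinable v σ
    · rw [dif_pos h, dif_pos (h.permute t), join_permute h, chainOf_permute,
        Equiv.Perm.decomposeFin.symm_sign]
      simp
    · rw [dif_neg h, dif_neg (by rwa [joinable_permute_iff]), smul_zero]

theorem cone_chainOf {v : V} {d : ℕ} {σ : OrderedSimplex X d} (h : Joinable v σ) :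
    cone R X v d (chainOf R σ) = chainOf R (join v σ h) := by
  rw [cone, chainLift_chainOf, dif_pos h]

theorem Joinable.face {v : V} {d : ℕ} {σ : OrderedSimplex X (d + 1)} (h : Joinable v σ)
    (i : Fin (d + 2)) : Joinable v (σ.face i) := by
  obtain ⟨h1, h2⟩ := h
  have hsub : Finset.univ.map (σ.face i).vertex ⊆ Finset.univ.map σ.vertex := by
    intro w hw
    simp only [Finset.mem_map, Finset.mem_univ, true_and] at hw ⊢
    obtain ⟨j, rfl⟩ := hw
    exact ⟨_, rfl⟩
  exact ⟨fun hv => h1 (hsub hv), (X.isRelLowerSet_faces h2).2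
    (Finset.cons_subset_cons.2 hsub) (by simp)⟩

theorem boundary_cone {v : V} {d : ℕ} {σ : OrderedSimplex X (d + 1)} (h : Joinable v σ) :
    boundary R X (d + 1) (cone R X v (d + 1) (chainOf R σ)) =
      chainOf R σ - cone R X v d (boundary R X d (chainOf R σ)) := by
  rw [cone_chainOf h, boundary_chainOf, boundary_chainOf, Fin.sum_univ_succ, map_sum,
    sub_eq_add_neg, ← Finset.sum_neg_distrib]
  congr 1
  · have : (join v σ h).face 0 = σ := by ext j; simp [join]
    simp [this]
  · refine Finset.sum_congr rfl fun i _ => ?_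
    have : (join v σ h).face i.succ = join v (σ.face i) (h.face i) := by
      ext j
      refine Fin.cases ?_ (fun j => ?_) j
      · simp [join]
      · simp [join]
    rw [this, map_smul, cone_chainOf (h.face i), Fin.val_succ, pow_succ]
    simp

theorem exists_chain_boundary_zero {v : V} {σ : OrderedSimplex X 0} (h : Joinable v σ) :
    ∃ τ : OrderedSimplex X 0, τ.vertex 0 = v ∧
      boundary R X 0 (cone R X v 0 (chainOf R σ)) = chainOf R σ - chainOf R τ := by
  refine ⟨(join v σ h).face 1, rfl, ?_⟩
  rw [cone_chainOf h, boundary_chainOf, Fin.sum_univ_two]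
  have : (join v σ h).face 0 = σ := by ext j; simp [join]
  simp [this, sub_eq_add_neg]

theorem exists_joinable (hX : StarProperty X) {d : ℕ} (z : Chain R X d) :
    ∃ (v : V) (c : OrderedSimplex X d →₀ R), (∀ σ ∈ c.support, Joinable v σ) ∧
      z = ∑ σ ∈ c.support, c σ • chainOf R σ := by
  classical
  obtain ⟨c, rfl⟩ := Submodule.mkQ_surjective _ z
  obtain ⟨v, hv, hj⟩ := hX (c.support.biUnion fun σ => Finset.univ.map σ.vertex)
  refine ⟨v, c, fun σ hσ => ?_, ?_⟩
  · have hsub := Finset.subset_biUnion_of_mem (fun σ : OrderedSimplex X d =>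
      Finset.univ.map σ.vertex) hσ
    exact ⟨fun h => hv (hsub h), hj _ hsub σ.mem_faces⟩
  · conv_lhs => rw [← Finsupp.sum_single c]
    rw [Finsupp.sum, map_sum]
    refine Finset.sum_congr rfl fun σ _ => ?_
    rw [chainOf, ← map_smul]
    simp

theorem exact_succ (hX : StarProperty X) {d : ℕ} (z : Chain R X (d + 1))
    (hz : boundary R X d z = 0) : ∃ y, boundary R X (d + 1) y = z := by
  obtain ⟨v, c, hc, hzc⟩ := exists_joinable hX z
  refine ⟨cone R X v (d + 1) z, ?_⟩
  have key : boundary R X (d + 1) (cone R X v (d + 1) z) =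
      z - cone R X v d (boundary R X d z) := by
    rw [hzc]
    simp only [map_sum, map_smul]
    rw [← Finset.sum_sub_distrib]
    refine Finset.sum_congr rfl fun σ hσ => ?_
    rw [boundary_cone (hc σ hσ), smul_sub]
  rw [key, hz, map_zero, sub_zero]

theorem exact_zero (hX : StarProperty X) (z : Chain R X 0)
    (hz : augmentation R X z = 0) : ∃ y, boundary R X 0 y = z := by
  obtain ⟨v, c, hc, hzc⟩ := exists_joinable hX z
  refine ⟨cone R X v 0 z, ?_⟩
  have hsum : ∑ σ ∈ c.support, c σ = 0 := by
    rw [hzc] at hz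
    simpa [map_sum] using hz
  let τ : OrderedSimplex X 0 := ⟨⟨fun _ => v, fun i j _ => Fin.ext (by lia)⟩, by
    convert X.singleton_mem v
    ext w; simp; rfl⟩
  have key : boundary R X 0 (cone R X v 0 z) = z - (∑ σ ∈ c.support, c σ) • chainOf R τ := by
    rw [hzc]
    simp only [map_sum, map_smul]
    rw [Finset.sum_smul, ← Finset.sum_sub_distrib]
    refine Finset.sum_congr rfl fun σ hσ => ?_
    obtain ⟨τ', hτ', h⟩ := exists_chain_boundary_zero (R := R) (hc σ hσ)
    have : τ' = τ := OrderedSimplex.ext' fun i => by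
      rw [show i = 0 from Fin.ext (by lia), hτ']; rfl
    rw [h, this, smul_sub]
  rw [key, hsum, zero_smul, sub_zero]

theorem augmentation_boundary : augmentation R X ∘ₗ boundary R X 0 = 0 :=
  chain_hom_ext fun σ => by simp [Fin.sum_univ_two]

theorem augmentation_surjective (hX : StarProperty X) :
    Function.Surjective (augmentation R X) := fun r => by
  obtain ⟨v, -, -⟩ := hX ∅
  let τ : OrderedSimplex X 0 := ⟨⟨fun _ => v, fun i j _ => Fin.ext (by lia)⟩, by
    convert X.singleton_mem v
    ext w; simp; rfl⟩
  exact ⟨r • chainOf R τ, by simp⟩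

end Chains

/-! ### Tautological classes -/

section Tautological

variable {R G : Type u} [CommRing R] [Group G]

/-- A resolution of the trivial `G`-module `R` (an acyclic `G`-chain complex): a non-negatively
graded chain complex of `G`-modules, with an augmentation onto `R`, exact in every degree. -/
structure AcyclicGComplex (R G : Type u) [CommRing R] [Group G] where
  complex : ChainComplex (Rep.{u} R G) ℕ
  aug : complex.X 0 ⟶ Rep.trivial R G R
  aug_d : ∀ x : complex.X 1, aug.hom ((complex.d 1 0).hom x) = 0
  aug_surjective : Function.Surjective aug.hom
  exact_zero : ∀ x : complex.X 0, aug.hom x = 0 → ∃ y, (complex.d 1 0).hom y = x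
  exact_succ : ∀ (d : ℕ) (x : complex.X (d + 1)), (complex.d (d + 1) d).hom x = 0 →
    ∃ y, (complex.d (d + 2) (d + 1)).hom y = x

/-- The simplicial chain complex of a `G`-complex with the star property. -/
def simplicialResolution (R : Type u) [CommRing R] {V : Type u} [MulAction G V]
    (X : GSimplicialComplex G V) (hX : StarProperty X) : AcyclicGComplex R G where
  complex := chainComplex R X
  aug := augmentationHom R X
  aug_d x := by
    rw [chainComplex_d]
    exact LinearMap.congr_fun augmentation_boundary x
  aug_surjective := augmentation_surjective hX
  exact_zero x hx := by
    rw [chainComplex_d]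
    exact TautologicalClass.exact_zero hX x hx
  exact_succ d x hx := by
    rw [chainComplex_d] at hx ⊢
    exact TautologicalClass.exact_succ hX x hx

variable (R G) in
/-- The augmentation of the bar resolution: `g • [] ↦ 1`. -/
def barAug : (Rep.barComplex R G).X 0 ⟶ Rep.trivial R G R :=
  Rep.ofHom (Representation.freeLift (Representation.trivial R G R) fun _ : Fin 0 → G => 1)

theorem barAug_d : (Rep.barComplex R G).d 1 0 ≫ barAug R G = 0 := by
  rw [Rep.barComplex.d_def]
  refine Rep.free_ext _ _ _ _ _ fun i => ?_
  change Representation.freeLift (Representation.trivial R G R) (fun _ : Fin 0 → G => (1 : R))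
    ((Rep.barComplex.d R G 0).hom (Finsupp.single i (.single 1 1))) = 0
  rw [Rep.barComplex.d_single, map_add, map_sum]
  simp

theorem exists_lift {α : Type u} {A B : Rep.{u} R G} (f : Rep.free R G α ⟶ B) (p : A ⟶ B)
    (h : ∀ a, ∃ x, p.hom x = f.hom (Finsupp.single a (.single 1 1))) :
    ∃ q : Rep.free R G α ⟶ A, q ≫ p = f := by
  choose x hx using h
  refine ⟨Rep.ofHom (Representation.freeLift A.ρ x), Rep.free_ext _ _ _ _ _ fun a => ?_⟩
  change p.hom (Representation.freeLift A.ρ x (Finsupp.single a (.single 1 1))) = _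
  rw [Representation.freeLift_single_single, map_one, Module.End.one_apply, one_smul]
  exact hx a

/-- The chain map of resolutions from the bar resolution exists. -/
theorem exists_comparison (C : AcyclicGComplex R G) :
    ∃ ψ : Rep.barComplex R G ⟶ C.complex, ψ.f 0 ≫ C.aug = barAug R G := by
  obtain ⟨zero, hzero⟩ := exists_lift (barAug R G) C.aug fun a => C.aug_surjective _
  obtain ⟨one, hone⟩ := exists_lift ((Rep.barComplex R G).d 1 0 ≫ zero) (C.complex.d 1 0)
    fun a => C.exact_zero _ (by
      have := barAug_d (R := R) (G := G)
      rw [← hzero, ← Category.assoc] at this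
      exact congrArg (fun f => f.hom (Finsupp.single a (.single 1 1))) this)
  refine ⟨ChainComplex.mkHom _ _ zero one hone fun n p => ?_, hzero⟩
  have hex := exists_lift ((Rep.barComplex R G).d (n + 2) (n + 1) ≫ p.2.1)
    (C.complex.d (n + 2) (n + 1)) fun a => C.exact_succ n _ (by
      have : ((Rep.barComplex R G).d (n + 2) (n + 1) ≫ p.2.1) ≫ C.complex.d (n + 1) n = 0 := by
        rw [Category.assoc, p.2.2, ← Category.assoc, HomologicalComplex.d_comp_d,
          Limits.zero_comp]
      exact congrArg (fun f => f.hom (Finsupp.single a (.single 1 1))) this)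
  exact ⟨hex.choose, hex.choose_spec⟩

/-- A chain map of resolutions `ψ` (respecting augmentations) from the bar resolution of `R` to
`C`; it is unique up to chain homotopy. -/
def comparison (C : AcyclicGComplex R G) : Rep.barComplex R G ⟶ C.complex :=
  (exists_comparison C).choose

theorem comparison_aug (C : AcyclicGComplex R G) :
    (comparison C).f 0 ≫ C.aug = barAug R G :=
  (exists_comparison C).choose_spec

theorem bar_cocycle {A : Rep.{u} R G} {d : ℕ} (φ : Rep.free R G (Fin d → G) ⟶ A)
    (h : Rep.barComplex.d R G d ≫ φ = 0) :
    inhomogeneousCochains.d A d (fun g => φ.hom (Finsupp.single g (.single 1 1))) = 0 := by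
  have h1 : (Rep.freeLiftLEquiv R G (Fin d → G) A).symm
      (fun g => φ.hom (Finsupp.single g (.single 1 1))) = φ :=
    (Rep.freeLiftLEquiv R G (Fin d → G) A).symm_apply_apply φ
  have h2 : (Rep.barComplex R G).d (d + 1) d ≫ φ = 0 := by
    rw [Rep.barComplex.d_def, h]
  rw [inhomogeneousCochains.d_eq]
  change Rep.freeLiftLEquiv R G (Fin (d + 1) → G) A ((Rep.barComplex R G).d (d + 1) d ≫
    (Rep.freeLiftLEquiv R G (Fin d → G) A).symm
      (fun g => φ.hom (Finsupp.single g (.single 1 1)))) = 0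
  rw [h1]
  exact (congrArg _ h2).trans (map_zero _)

/-- The group cohomology class `[ψ^* T] ∈ H^d(G, A)` of a `G`-equivariant `A`-valued
`d`-cocycle `T` on `C`. -/
def classOfCocycle (C : AcyclicGComplex R G) {A : Rep.{u} R G} {d : ℕ} (T : C.complex.X d ⟶ A)
    (hT : C.complex.d (d + 1) d ≫ T = 0) : groupCohomology A d :=
  groupCohomology.π A d (groupCohomology.cocyclesMk
    (fun g => ((comparison C).f d ≫ T).hom (Finsupp.single g (.single 1 1))) (by
      refine bar_cocycle ((comparison C).f d ≫ T) ?_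
      rw [← Rep.barComplex.d_def, ← Category.assoc, ← (comparison C).comm, Category.assoc, hT,
        Limits.comp_zero]))

variable (C : ChainComplex (Rep.{u} R G) ℕ) (d : ℕ)

/-- The boundaries `B_d ⊆ C_d`. -/
def boundaries : Submodule R (C.X d) := LinearMap.range (C.d (d + 1) d).hom.toLinearMap

/-- The `G`-module `C_d / B_d`. -/
def quotientAction : Representation R G (C.X d ⧸ boundaries C d) :=
  (C.X d).ρ.quotient (boundaries C d) (by
    rintro g _ ⟨x, rfl⟩
    exact ⟨(C.X (d + 1)).ρ g x, Rep.hom_comm_apply _ g x⟩)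

/-- The coefficient group `U_d = (C_d / B_d)_G`. -/
abbrev Coeff : Type u := (quotientAction C d).Coinvariants

/-- The quotient map `C_d → U_d`. -/
def toCoeff : C.X d →ₗ[R] Coeff C d :=
  Representation.Coinvariants.mk (quotientAction C d) ∘ₗ (boundaries C d).mkQ

/-- The tautological cocycle `T^d_{C/G} : C_d → U_d`. -/
def tautologicalCocycle : C.X d ⟶ Rep.trivial R G (Coeff C d) :=
  Rep.ofHom (ρ := (C.X d).ρ) (σ := Representation.trivial R G (Coeff C d)) ⟨toCoeff C d, fun g => by
    refine LinearMap.ext fun x => ?_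
    exact Representation.Coinvariants.mk_self_apply (quotientAction C d) g
      ((boundaries C d).mkQ x)⟩

theorem d_tautologicalCocycle : C.d (d + 1) d ≫ tautologicalCocycle C d = 0 := by
  refine Rep.hom_ext (Representation.IntertwiningMap.ext (LinearMap.ext fun x => ?_))
  change Representation.Coinvariants.mk _ ((boundaries C d).mkQ ((C.d (d + 1) d).hom x)) = 0
  have : (boundaries C d).mkQ ((C.d (d + 1) d).hom x) = 0 :=
    (Submodule.Quotient.mk_eq_zero _).2 (LinearMap.mem_range_self _ x)
  rw [this, map_zero]

/-- The tautological class `τ^d_{G,C} ∈ H^d(G, U_d)`. -/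
def tautologicalClass (C : AcyclicGComplex R G) (d : ℕ) :
    groupCohomology (Rep.trivial R G (Coeff C.complex d)) d :=
  classOfCocycle C (tautologicalCocycle C.complex d) (d_tautologicalCocycle C.complex d)

/-- The map `H^d(G, A) → H^d(G, B)` induced by a homomorphism of (trivial) coefficients. -/
def coeffMap {A B : Type u} [AddCommGroup A] [AddCommGroup B] [Module R A] [Module R B]
    (f : A →ₗ[R] B) (d : ℕ) :
    groupCohomology (Rep.trivial R G A) d →ₗ[R] groupCohomology (Rep.trivial R G B) d :=
  (groupCohomology.map (MonoidHom.id G) (B := Rep.trivial R G B) (A := Rep.trivial R G A)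
    (Rep.ofHom (ρ := Representation.trivial R G A) (σ := Representation.trivial R G B)
      ⟨f, fun _ => rfl⟩) d).hom

/-- The map `φ^* : H^d(H, A) → H^d(G, A)` for trivial coefficients. -/
def pullback {H : Type u} [Group H] (φ : G →* H) (A : Type u) [AddCommGroup A] [Module R A]
    (d : ℕ) :
    groupCohomology (Rep.trivial R H A) d →ₗ[R] groupCohomology (Rep.trivial R G A) d :=
  (groupCohomology.map φ (B := Rep.trivial R G A) (A := Rep.trivial R H A)
    (Rep.ofHom (ρ := Representation.trivial R G A) (σ := Representation.trivial R G A)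
      ⟨LinearMap.id, fun _ => rfl⟩) d).hom

end Tautological

/-! ### Complexes of generic points -/

section Generic

variable {K P : Type u} [Field K] {n : ℕ}

/-- A finite set `s` of points, with representing vectors `rep p`, is generic if every subset of
`s` with at most `n` elements is represented by linearly independent vectors of `Kⁿ`. -/
def IsGeneric (rep : P → Fin n → K) (s : Finset P) : Prop :=
  ∀ t ⊆ s, t.card ≤ n → LinearIndepOn K rep (t : Set P)

theorem linearIndepOn_rescale {ι : Type*} {v w : ι → Fin n → K} {s : Set ι}
    (L : (Fin n → K) ≃ₗ[K] (Fin n → K)) (h : ∀ i, ∃ c : K, c ≠ 0 ∧ w i = c • L (v i))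
    (hv : LinearIndepOn K v s) : LinearIndepOn K w s := by
  choose c hc hw using h
  have h1 : LinearIndependent K (fun i : s => L (v i)) :=
    LinearIndependent.map' hv L.toLinearMap L.ker
  have h2 := h1.units_smul (fun i : s => Units.mk0 (c i) (hc i))
  refine (linearIndependent_equiv' (Equiv.refl s) ?_).1 h2
  funext i
  simp [hw, Units.smul_def]

/-- The complex of generic finite sets of points, with the action of a group `Γ` which acts on
representing vectors through linear automorphisms, up to non-zero scalars. -/
def genericComplex {Γ : Type u} [Group Γ] [MulAction Γ P] (rep : P → Fin n → K)
    (rep_ne : ∀ p, rep p ≠ 0)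
    (act : ∀ γ : Γ, ∃ L : (Fin n → K) ≃ₗ[K] (Fin n → K), ∀ p, ∃ c : K, c ≠ 0 ∧
      rep (γ • p) = c • L (rep p)) : GSimplicialComplex Γ P where
  faces := {s | s.Nonempty ∧ IsGeneric rep s}
  isRelLowerSet_faces := fun s hs => ⟨hs.1, fun t hts ht =>
    ⟨ht, fun r hr => hs.2 r (hr.trans hts)⟩⟩
  singleton_mem p := ⟨by simp, fun t ht _ => LinearIndepOn.mono
    (LinearIndepOn.singleton (rep_ne p)) (by exact_mod_cast ht)⟩
  smul_mem γ s hs := by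
    refine ⟨hs.1.map, fun t ht hn => ?_⟩
    obtain ⟨L, hL⟩ := act γ
    obtain ⟨t', ht', rfl⟩ := Finset.subset_map_iff.1 ht
    have h1 := hs.2 t' ht' (by simpa using hn)
    rw [Finset.coe_map]
    have h2 : LinearIndepOn K (rep ∘ fun p : P => γ • p) (t' : Set P) :=
      linearIndepOn_rescale L hL h1
    exact h2.image_of_comp

theorem genericComplex_starProperty {Γ : Type u} [Group Γ] [MulAction Γ P] [Infinite K]
    (hn : 2 ≤ n) (rep : P → Fin n → K)
    (rep_ne : ∀ p, rep p ≠ 0)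
    (act : ∀ γ : Γ, ∃ L : (Fin n → K) ≃ₗ[K] (Fin n → K), ∀ p, ∃ c : K, c ≠ 0 ∧
      rep (γ • p) = c • L (rep p))
    (surj : ∀ v : Fin n → K, v ≠ 0 → ∃ p, ∃ c : K, c ≠ 0 ∧ rep p = c • v) :
    StarProperty (genericComplex rep rep_ne act) := by
  classical
  intro Y
  let S : Finset (Submodule K (Fin n → K)) :=
    (Y.powerset.filter (fun t => t.card + 1 ≤ n)).image
      fun t : Finset P => Submodule.span K (rep '' (t : Set P))
  have hS : ⊤ ∉ S := by
    intro h
    obtain ⟨t, ht, htop⟩ := Finset.mem_image.1 h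
    have hcard := (Finset.mem_filter.1 ht).2
    have h1 : Module.finrank K (Submodule.span K (rep '' (t : Set P))) ≤ t.card := by
      rw [← Finset.coe_image]
      exact (finrank_span_finset_le_card _).trans Finset.card_image_le
    rw [htop, finrank_top, Module.finrank_fin_fun] at h1
    omega
  have hne := Subspace.biUnion_ne_univ_of_top_notMem hS
  obtain ⟨v, hv⟩ := (Set.ne_univ_iff_exists_notMem _).1 hne
  have hv' : ∀ t ⊆ Y, t.card + 1 ≤ n → v ∉ Submodule.span K (rep '' (t : Set P)) := by
    intro t ht hc hmem
    refine hv (Set.mem_biUnion (x := Submodule.span K (rep '' (t : Set P))) ?_ hmem)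
    exact Finset.mem_image.2 ⟨t, Finset.mem_filter.2 ⟨Finset.mem_powerset.2 ht, hc⟩, rfl⟩
  have hv0 : v ≠ 0 := by
    rintro rfl
    exact hv' ∅ (by simp) (by simp; omega) (Submodule.zero_mem _)
  obtain ⟨p, c, hc, hp⟩ := surj v hv0
  have hp' : ∀ t ⊆ Y, t.card + 1 ≤ n → rep p ∉ Submodule.span K (rep '' (t : Set P)) := by
    intro t ht hcard hmem
    rw [hp, Submodule.smul_mem_iff _ hc] at hmem
    exact hv' t ht hcard hmem
  have hpY : p ∉ Y := fun hpY =>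
    hp' {p} (by simpa using hpY) (by simpa using hn) (Submodule.subset_span (by simp))
  refine ⟨p, hpY, fun s hs hsf => ⟨by simp, fun t ht hcard => ?_⟩⟩
  have hts : t.erase p ⊆ s := by
    intro q hq
    have := ht (Finset.mem_of_mem_erase hq)
    rw [Finset.mem_cons] at this
    exact this.resolve_left (Finset.ne_of_mem_erase hq)
  by_cases hpt : p ∈ t
  · have hcard' : (t.erase p).card + 1 = t.card := Finset.card_erase_add_one hpt
    have h1 := hsf.2 (t.erase p) hts (by omega)
    rw [← Finset.insert_erase hpt, Finset.coe_insert]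
    exact h1.insert (hp' _ (hts.trans hs) (by omega))
  · rw [Finset.erase_eq_of_notMem hpt] at hts
    exact hsf.2 t hts hcard

/-- The tuple of vectors `(e₁, …, eₙ, α₁e₁ + ⋯ + αₙeₙ)`. -/
def standardTuple (α : Fin n → K) : Fin (n + 1) → Fin n → K :=
  Fin.snoc (fun i => Pi.single i 1) α

theorem standardTuple_indep (α : Fin n → K) (hα : ∀ i, α i ≠ 0) (j : Fin (n + 1)) :
    LinearIndepOn K (standardTuple α) {j}ᶜ := by
  rw [linearIndepOn_iff']
  intro t g ht hsum i hi
  set g' : Fin (n + 1) → K := fun i => if i ∈ t then g i else 0 with hg'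
  have hj : g' j = 0 := if_neg fun h => by simpa using ht h
  have hsum' : ∑ i, g' i • standardTuple α i = 0 := by
    rw [← hsum, ← Finset.sum_subset (Finset.subset_univ t)]
    · exact Finset.sum_congr rfl fun i hi => by simp [hg', hi]
    · intro i _ hi
      simp [hg', hi]
  have hcoord : ∀ k : Fin n, g' k.castSucc + g' (Fin.last n) * α k = 0 := by
    intro k
    have := congrFun hsum' k
    rw [Fin.sum_univ_castSucc] at this
    simpa [standardTuple, Finset.sum_apply, Pi.single_apply] using this
  have hlast : g' (Fin.last n) = 0 := by
    induction j using Fin.lastCases with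
    | last => exact hj
    | cast k =>
      have := hcoord k
      rw [hj, zero_add] at this
      exact (mul_eq_zero.1 this).resolve_right (hα k)
  have hall : g' i = 0 := by
    induction i using Fin.lastCases with
    | last => exact hlast
    | cast k => simpa [hlast] using hcoord k
  simpa [hg', hi] using hall

theorem standardTuple_ne (hn : 2 ≤ n) (α : Fin n → K) (hα : ∀ i, α i ≠ 0) (i : Fin (n + 1)) :
    standardTuple α i ≠ 0 := by
  obtain ⟨j, hj⟩ : ∃ j : Fin (n + 1), j ≠ i := by
    have : Nontrivial (Fin (n + 1)) := Fin.nontrivial_iff_two_le.2 (by omega)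
    exact exists_ne i
  exact (standardTuple_indep α hα j).ne_zero (by simpa using hj.symm)

/-- The ordered `n`-simplex `([e₁], …, [eₙ], [α₁e₁ + ⋯ + αₙeₙ])`, where all `αᵢ ≠ 0`. -/
def standardSimplex {Γ : Type u} [Group Γ] [MulAction Γ P]
    (hn : 2 ≤ n) (rep : P → Fin n → K)
    (rep_ne : ∀ p, rep p ≠ 0)
    (act : ∀ γ : Γ, ∃ L : (Fin n → K) ≃ₗ[K] (Fin n → K), ∀ p, ∃ c : K, c ≠ 0 ∧
      rep (γ • p) = c • L (rep p))
    (point : ∀ v : Fin n → K, v ≠ 0 → P)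
    (rep_point : ∀ v hv, ∃ c : K, c ≠ 0 ∧ rep (point v hv) = c • v)
    (α : Fin n → K) (hα : ∀ i, α i ≠ 0) :
    OrderedSimplex (genericComplex rep rep_ne act) n :=
  have indep : ∀ j, LinearIndepOn K
      (fun i => rep (point (standardTuple α i) (standardTuple_ne hn α hα i))) {j}ᶜ := fun j =>
    linearIndepOn_rescale (LinearEquiv.refl K _) (fun i => rep_point _ _)
      (standardTuple_indep α hα j)
  { vertex := ⟨fun i => point (standardTuple α i) (standardTuple_ne hn α hα i), by
      intro i j hij
      obtain ⟨k, hki, hkj⟩ : ∃ k : Fin (n + 1), k ≠ i ∧ k ≠ j := by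
        obtain ⟨k, hk⟩ := Finset.exists_mem_notMem_of_card_lt_card
          (s := {i, j}) (t := (Finset.univ : Finset (Fin (n + 1))))
          (lt_of_le_of_lt (Finset.card_le_two) (by simp; omega))
        exact ⟨k, by simp at hk; tauto⟩
      exact (indep k).injOn (by simpa using hki.symm) (by simpa using hkj.symm)
        (congrArg rep hij)⟩
    mem_faces := by
      refine ⟨by simp, fun t ht hcard => ?_⟩
      obtain ⟨t', -, rfl⟩ := Finset.subset_map_iff.1 ht
      rw [Finset.card_map] at hcard
      obtain ⟨k, -, hk⟩ := Finset.exists_mem_notMem_of_card_lt_card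
        (s := t') (t := (Finset.univ : Finset (Fin (n + 1)))) (by simp; omega)
      rw [Finset.coe_map]
      refine LinearIndepOn.image_of_comp (f := fun i => point (standardTuple α i)
        (standardTuple_ne hn α hα i)) (g := rep) ((indep k).mono ?_)
      intro i hi hik
      exact hk (by simpa [← (show i = k from hik)] using hi) }

theorem rep_projPoint (v : Fin n → K) (hv : v ≠ 0) :
    ∃ c : K, c ≠ 0 ∧ (Projectivization.mk K v hv).rep = c • v := by
  obtain ⟨a, ha⟩ := Projectivization.exists_smul_eq_mk_rep K v hv
  exact ⟨a, a.ne_zero, ha.symm⟩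

end Generic

/-! ### The groups -/

section Groups

variable (K : Type u) [Field K] [LinearOrder K] [IsStrictOrderedRing K] (n : ℕ)

/-- The scalar matrices in `GL₊(n, K)`. -/
def scalars : Subgroup (Matrix.GLPos (Fin n) K) :=
  (Matrix.GeneralLinearGroup.scalar (R := K) (Fin n)).range.comap
    (Matrix.GLPos (Fin n) K).subtype

/-- The scalar matrices `λ I` with `λ > 0`. -/
def posScalars : Subgroup (Matrix.GLPos (Fin n) K) :=
  ((Units.posSubgroup K).map (Matrix.GeneralLinearGroup.scalar (R := K) (Fin n))).comap
    (Matrix.GLPos (Fin n) K).subtype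

instance : (scalars K n).Normal where
  conj_mem := by
    rintro x ⟨c, hc⟩ g
    refine ⟨c, ?_⟩
    simp only [Subgroup.coe_subtype, Subgroup.coe_mul, Subgroup.coe_inv] at hc ⊢
    rw [← hc, ← Matrix.GeneralLinearGroup.scalar_commute, mul_inv_cancel_right]

instance : (posScalars K n).Normal where
  conj_mem := by
    rintro x ⟨c, hc0, hc⟩ g
    refine ⟨c, hc0, ?_⟩
    simp only [Subgroup.coe_subtype, Subgroup.coe_mul, Subgroup.coe_inv] at hc ⊢
    rw [← hc, ← Matrix.GeneralLinearGroup.scalar_commute, mul_inv_cancel_right]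

/-- `PGL₊(n, K)`. -/
abbrev PGLPlus : Type u := Matrix.GLPos (Fin n) K ⧸ scalars K n

/-- `P₊GL₊(n, K)`. -/
abbrev PPlusGLPlus : Type u := Matrix.GLPos (Fin n) K ⧸ posScalars K n

theorem posScalars_le : posScalars K n ≤ scalars K n := by
  rintro x ⟨c, -, hc⟩
  exact ⟨c, hc⟩

/-- The natural projection `P₊GL₊(n, K) → PGL₊(n, K)`. -/
def projection : PPlusGLPlus K n →* PGLPlus K n :=
  QuotientGroup.map (posScalars K n) (scalars K n) (MonoidHom.id _) (posScalars_le K n)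

/-- The projective space `ℙⁿ⁻¹(K)`. -/
abbrev ProjPoint : Type u := Projectivization K (Fin n → K)

/-- The positive projective space `ℙ₊ⁿ⁻¹(K)`: non-zero vectors modulo positive scalars. -/
abbrev RayPoint : Type u := Module.Ray K (Fin n → K)

variable {K n} in
theorem smul_eq_of_scalar {x : Matrix.GLPos (Fin n) K} {c : Kˣ}
    (hc : Matrix.GeneralLinearGroup.scalar (Fin n) c = (Matrix.GLPos (Fin n) K).subtype x)
    (v : Fin n → K) : x • v = (c : K) • v := by
  change ((Matrix.GLPos (Fin n) K).subtype x : Matrix (Fin n) (Fin n) K).mulVec v = _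
  rw [← hc, Matrix.GeneralLinearGroup.coe_scalar]
  ext i
  simp [Matrix.scalar_apply, Matrix.mulVec_diagonal]

/-- The action of `PGL₊(n, K)` on `ℙⁿ⁻¹(K)`, `[g] [v] = [g v]`. -/
instance : MulAction (PGLPlus K n) (ProjPoint K n) :=
  MulAction.compHom _ (QuotientGroup.lift (scalars K n)
    (MulAction.toPermHom (Matrix.GLPos (Fin n) K) (ProjPoint K n)) (by
      rintro x ⟨c, hc⟩
      refine MonoidHom.mem_ker.2 (Equiv.ext fun p => ?_)
      induction p using Projectivization.ind with | _ v hv =>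
      have hx : x • v = (c : K) • v := smul_eq_of_scalar hc v
      change Projectivization.mk K (x • v) ((smul_ne_zero_iff_ne x).2 hv) =
        Projectivization.mk K v hv
      rw [Projectivization.mk_eq_mk_iff']
      exact ⟨c, hx.symm⟩))

/-- The action of `P₊GL₊(n, K)` on `ℙ₊ⁿ⁻¹(K)`, `[g] [v] = [g v]`. -/
instance : MulAction (PPlusGLPlus K n) (RayPoint K n) :=
  MulAction.compHom _ (QuotientGroup.lift (posScalars K n)
    (MulAction.toPermHom (Matrix.GLPos (Fin n) K) (RayPoint K n)) (by
      rintro x ⟨c, hc0, hc⟩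
      refine MonoidHom.mem_ker.2 (Equiv.ext fun p => ?_)
      induction p using Module.Ray.ind with | _ v hv =>
      have hx : x • v = (c : K) • v := smul_eq_of_scalar hc v
      change rayOfNeZero K (x • v) ((smul_ne_zero_iff_ne x).2 hv) = rayOfNeZero K v hv
      rw [ray_eq_iff, hx]
      exact SameRay.sameRay_pos_smul_left v hc0))

variable {K n} in
theorem mk_smul_proj (g : Matrix.GLPos (Fin n) K) (p : ProjPoint K n) :
    (QuotientGroup.mk g : PGLPlus K n) • p = g • p := rfl

variable {K n} in
theorem mk_smul_ray (g : Matrix.GLPos (Fin n) K) (p : RayPoint K n) :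
    (QuotientGroup.mk g : PPlusGLPlus K n) • p = g • p := rfl

variable {K n} in
theorem rep_rayPoint (v : Fin n → K) (hv : v ≠ 0) :
    ∃ c : K, c ≠ 0 ∧ (rayOfNeZero K v hv).someVector = c • v := by
  have h := (ray_eq_iff (rayOfNeZero K v hv).someVector_ne_zero hv).1
    (Module.Ray.someVector_ray _)
  obtain ⟨a, b, ha, hb, hab⟩ := h.exists_pos (Module.Ray.someVector_ne_zero _) hv
  refine ⟨a⁻¹ * b, by positivity, ?_⟩
  rw [mul_smul, ← hab, smul_smul, inv_mul_cancel₀ ha.ne', one_smul]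

variable {K n} in
theorem rep_smul_projPoint (γ : PGLPlus K n) :
    ∃ L : (Fin n → K) ≃ₗ[K] (Fin n → K), ∀ p : ProjPoint K n, ∃ c : K, c ≠ 0 ∧
      (γ • p).rep = c • L p.rep := by
  induction γ using QuotientGroup.induction_on with | H g =>
  refine ⟨DistribMulAction.toLinearEquiv K (Fin n → K) g, fun p => ?_⟩
  have h : (QuotientGroup.mk g : PGLPlus K n) • p =
      Projectivization.mk K (g • p.rep) ((smul_ne_zero_iff_ne g).2 p.rep_nonzero) := by
    conv_lhs => rw [← p.mk_rep]
    rfl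
  rw [h]
  exact rep_projPoint _ _

variable {K n} in
theorem rep_smul_rayPoint (γ : PPlusGLPlus K n) :
    ∃ L : (Fin n → K) ≃ₗ[K] (Fin n → K), ∀ p : RayPoint K n, ∃ c : K, c ≠ 0 ∧
      (γ • p).someVector = c • L p.someVector := by
  induction γ using QuotientGroup.induction_on with | H g =>
  refine ⟨DistribMulAction.toLinearEquiv K (Fin n → K) g, fun p => ?_⟩
  have h : (QuotientGroup.mk g : PPlusGLPlus K n) • p =
      rayOfNeZero K (g • p.someVector) ((smul_ne_zero_iff_ne g).2 p.someVector_ne_zero) := by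
    conv_lhs => rw [← p.someVector_ray]
    rfl
  rw [h]
  exact rep_rayPoint _ _

end Groups

/-! ### The Euler classes -/

section Euler

/-- The ring of integers, in the universe of `K`. -/
abbrev IntU : Type u := ULift.{u} ℤ

variable (K : Type u) [Field K] [LinearOrder K] [IsStrictOrderedRing K] (n : ℕ)

/-- The complex `X` of generic tuples of points of `ℙⁿ⁻¹(K)`, acted upon by `PGL₊(n, K)`. -/
def projComplex : GSimplicialComplex (PGLPlus K n) (ProjPoint K n) :=
  genericComplex (fun p : ProjPoint K n => p.rep) (fun p => p.rep_nonzero) rep_smul_projPoint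

/-- The complex `X₊` of generic tuples of points of `ℙ₊ⁿ⁻¹(K)`, acted upon by `P₊GL₊(n, K)`. -/
def rayComplex : GSimplicialComplex (PPlusGLPlus K n) (RayPoint K n) :=
  genericComplex (fun p : RayPoint K n => p.someVector) (fun p => p.someVector_ne_zero)
    rep_smul_rayPoint

variable {n}

theorem projComplex_star (hn : 2 ≤ n) : StarProperty (projComplex K n) :=
  genericComplex_starProperty hn _ _ _ fun v hv => ⟨_, rep_projPoint v hv⟩

theorem rayComplex_star (hn : 2 ≤ n) : StarProperty (rayComplex K n) :=
  genericComplex_starProperty hn _ _ _ fun v hv => ⟨_, rep_rayPoint v hv⟩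

/-- `C_* X` as a resolution of `ℤ` over `PGL₊(n, K)`. -/
def projResolution (hn : 2 ≤ n) : AcyclicGComplex IntU.{u} (PGLPlus K n) :=
  simplicialResolution IntU.{u} (projComplex K n) (projComplex_star K hn)

/-- `C_* X₊` as a resolution of `ℤ` over `P₊GL₊(n, K)`. -/
def rayResolution (hn : 2 ≤ n) : AcyclicGComplex IntU.{u} (PPlusGLPlus K n) :=
  simplicialResolution IntU.{u} (rayComplex K n) (rayComplex_star K hn)

variable (n) in
/-- The coefficient group `U = U_n(X)`. -/
abbrev U : Type u := Coeff (chainComplex IntU.{u} (projComplex K n)) n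

variable (n) in
/-- The coefficient group `U₊ = U_n(X₊)`. -/
abbrev UPlus : Type u := Coeff (chainComplex IntU.{u} (rayComplex K n)) n

/-- The Euler class `eu ∈ H^n(PGL₊(n, K), U)`. -/
def eu (hn : 2 ≤ n) : groupCohomology (Rep.trivial IntU.{u} (PGLPlus K n) (U K n)) n :=
  tautologicalClass (projResolution K hn) n

/-- The Euler class `eu₊ ∈ H^n(P₊GL₊(n, K), U₊)`. -/
def euPlus (hn : 2 ≤ n) :
    groupCohomology (Rep.trivial IntU.{u} (PPlusGLPlus K n) (UPlus K n)) n :=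
  tautologicalClass (rayResolution K hn) n

/-- The symbol `[+] ∈ U`: the class of the simplex `([e₁], …, [eₙ], [e₁ + ⋯ + eₙ])` of `X`. -/
def symbolPos (hn : 2 ≤ n) : U K n :=
  toCoeff (chainComplex IntU.{u} (projComplex K n)) n
    (chainOf IntU.{u} (standardSimplex hn _ _ _ (Projectivization.mk K) rep_projPoint
      (fun _ => 1) (fun _ => one_ne_zero)))

/-- The symbol `a⁺ ∈ U₊`: the class of the simplex `([e₁], …, [eₙ], [v_a])` of `X₊`, where
`v_a = e₁ + ⋯ + e_a - (e_{a+1} + ⋯ + eₙ)`. -/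
def symbolPlus (hn : 2 ≤ n) (a : ℕ) : UPlus K n :=
  toCoeff (chainComplex IntU.{u} (rayComplex K n)) n
    (chainOf IntU.{u} (standardSimplex hn _ _ _ (rayOfNeZero K) rep_rayPoint
      (fun i => if (i : ℕ) < a then 1 else -1) (fun i => by split_ifs <;> simp)))

end Euler

end
end TautologicalClass

open TautologicalClass

/-! An `n`-simplex of `X₊` is represented by `n + 1` generic vectors, which satisfy one linear
relation up to a scalar. The signed minors `relCoeff` normalise it, all of them are non-zero, and
`negCount` counts the negative ones. Matrices of positive determinant and positive rescalings
preserve this count, while an odd permutation of the vertices reverses every sign and so replaces a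
count `k` by `n + 1 - k`. Hence each function `w` with `w (n + 1 - k) = -w k` gives an invariant
alternating cochain `w ∘ negCount`.

Such a cochain is automatically a cocycle (`sum_negCount_face`). The relations among `n + 2` vectors
of `Kⁿ` form a plane, and by the Plücker relation the minors `relCoeff₂` are, up to a common factor,
the determinants of pairs of Gale dual vectors in the plane. The count of a face is the number of
dual vectors on one side of a line, and the alternating sum telescopes as the line makes half a
turn.

Two choices of `w` matter. The functions `coordCount n a` give homomorphisms on `U₊` dual to the
symbols `a⁺`. The function `(-1) ^ k` records the sign of the product of the coefficients; for even
`n` this is unchanged by arbitrary non-zero rescalings, so it lives on `X` and identifies `U` with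
`ℤ`. That the symbols generate follows by moving a suitably permuted simplex to a standard one by a
matrix of positive determinant.

The formula for the classes is then the identity `(-1) ^ k = ∑ (-1) ^ a * coordCount n a k`: under
the chain map from rays to points, the two cocycles on `C_n X₊` coincide. Naturality of classes of
cocycles (`pullback_classOfCocycle`), which rests on uniqueness of comparison maps up to homotopy,
transfers this equality to cohomology. -/

namespace TautologicalClass

/-! ### Linear relations among vectors and signed minors -/

section RelationCoefficients

variable {K : Type*} [Field K] {n : ℕ}

/-- The coefficients of the linear relation `∑ relCoeff v i • v i = 0` between `n + 1` vectors of
`Kⁿ`: up to the sign `(-1)^i`, the maximal minors of the matrix of the vectors. -/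
def relCoeff (v : Fin (n + 1) → Fin n → K) (i : Fin (n + 1)) : K :=
  (Matrix.of fun k => Fin.cons (α := fun _ => K) ((Pi.single i 1 : Fin (n + 1) → K) k) (v k)).det

theorem relCoeff_eq_minor (v : Fin (n + 1) → Fin n → K) (i : Fin (n + 1)) :
    relCoeff v i = (-1) ^ (i : ℕ) * (Matrix.of fun k => v (i.succAbove k)).det := by
  rw [relCoeff, Matrix.det_succ_column_zero, Finset.sum_eq_single i]
  · simp only [Matrix.of_apply, Fin.cons_zero, Pi.single_eq_same, mul_one]
    congr 2
  · intro k _ hk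
    simp [Pi.single_eq_of_ne hk]
  · simp

/-- Cramer's rule: replacing the indicator column by the `c`-th coordinates gives a matrix with a
repeated column, and expanding its zero determinant along that column gives the `c`-th coordinate of
the relation. -/
theorem sum_relCoeff_smul (v : Fin (n + 1) → Fin n → K) : ∑ i, relCoeff v i • v i = 0 := by
  ext c
  have h : (Matrix.of fun k => Fin.cons (α := fun _ => K) (v k c) (v k)).det = 0 :=
    Matrix.det_zero_of_column_eq (i := 0) (j := c.succ) (Fin.succ_ne_zero c).symm (by simp)
  rw [Matrix.det_succ_column_zero] at h
  simp only [Finset.sum_apply, Pi.smul_apply, smul_eq_mul, Pi.zero_apply]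
  rw [← h]
  refine Finset.sum_congr rfl fun i _ => ?_
  rw [relCoeff_eq_minor]
  simp only [Matrix.of_apply, Fin.cons_zero]
  rw [mul_right_comm]
  rfl

/-- Permuting the rows carries the indicator column along. An odd permutation thus flips every sign
in the relation, which is why only antisymmetric functions of the count are used later. -/
theorem relCoeff_permute (v : Fin (n + 1) → Fin n → K) (t : Equiv.Perm (Fin (n + 1)))
    (i : Fin (n + 1)) :
    relCoeff (v ∘ t) i = ((Equiv.Perm.sign t : ℤ) : K) * relCoeff v (t i) := by
  rw [relCoeff, relCoeff, ← Matrix.det_permute]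
  congr 1
  ext k c
  simp [Matrix.submatrix, Pi.single_apply]

/-- The factor omits `c i`, so it depends on `i`: positive `c` and `g.det` preserve each sign,
whereas general `c` control only the product of all coefficients. -/
theorem relCoeff_map_smul (g : Matrix (Fin n) (Fin n) K) (c : Fin (n + 1) → K)
    (v : Fin (n + 1) → Fin n → K) (i : Fin (n + 1)) :
    relCoeff (fun k => c k • g.mulVec (v k)) i =
      (∏ k, c (i.succAbove k)) * g.det * relCoeff v i := by
  have h : (Matrix.of fun k => c (i.succAbove k) • g.mulVec (v (i.succAbove k))) =
      Matrix.diagonal (fun k => c (i.succAbove k)) *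
        ((Matrix.of fun k => v (i.succAbove k)) * g.transpose) := by
    ext k l
    rw [Matrix.diagonal_mul]
    simp [Matrix.mul_apply, Matrix.mulVec, dotProduct, mul_comm]
  rw [relCoeff_eq_minor, relCoeff_eq_minor, h]
  simp only [Matrix.det_mul, Matrix.det_diagonal, Matrix.det_transpose]
  ring

theorem relCoeff_ne_zero {v : Fin (n + 1) → Fin n → K} {i : Fin (n + 1)}
    (h : LinearIndependent K fun k => v (i.succAbove k)) : relCoeff v i ≠ 0 := by
  rw [relCoeff_eq_minor]
  refine mul_ne_zero (pow_ne_zero _ (by simp)) ?_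
  exact ((Matrix.isUnit_iff_isUnit_det _).1 (Matrix.linearIndependent_rows_iff_isUnit.1 h)).ne_zero

/-- The signed minors of `n + 2` vectors of `Kⁿ`, omitting two of them. -/
def relCoeff₂ (v : Fin (n + 2) → Fin n → K) (i j : Fin (n + 2)) : K :=
  (Matrix.of fun k => Fin.cons (α := fun _ => K) ((Pi.single i 1 : Fin (n + 2) → K) k)
    (Fin.cons (α := fun _ => K) ((Pi.single j 1 : Fin (n + 2) → K) k) (v k))).det

theorem relCoeff₂_antisymm (v : Fin (n + 2) → Fin n → K) (i j : Fin (n + 2)) :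
    relCoeff₂ v j i = -relCoeff₂ v i j := by
  rw [relCoeff₂, relCoeff₂]
  set A := (Matrix.of fun k => Fin.cons (α := fun _ => K) ((Pi.single i 1 : Fin (n + 2) → K) k)
    (Fin.cons (α := fun _ => K) ((Pi.single j 1 : Fin (n + 2) → K) k) (v k))) with hA
  have h := Matrix.det_permute' (Equiv.swap 0 1) A
  rw [Equiv.Perm.sign_swap (by simp)] at h
  simp only [Units.val_neg, Units.val_one, Int.cast_neg, Int.cast_one, neg_mul, one_mul] at h
  rw [← h]
  congr 1
  ext k c
  refine Fin.cases ?_ (fun c => Fin.cases ?_ (fun c => ?_) c) c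
  · simp [hA]
  · simp [hA]
  · have h0 : c.succ.succ ≠ (0 : Fin (n + 2)) := Fin.succ_ne_zero _
    have h1 : c.succ.succ ≠ (1 : Fin (n + 2)) := by
      rw [← Fin.succ_zero_eq_one]
      exact fun h => Fin.succ_ne_zero _ (Fin.succ_injective _ h)
    simp [hA, Equiv.swap_apply_of_ne_of_ne h0 h1]

theorem relCoeff₂_self (v : Fin (n + 2) → Fin n → K) (i : Fin (n + 2)) : relCoeff₂ v i i = 0 :=
  Matrix.det_zero_of_column_eq (i := 0) (j := 1) (by simp) (by simp)

/-- Off the diagonal, row `i` of the two-index minors is the relation of the `i`-th face, multiplied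
by the very sign which that face carries in the boundary. -/
theorem relCoeff₂_succAbove (v : Fin (n + 2) → Fin n → K) (i : Fin (n + 2)) (j : Fin (n + 1)) :
    relCoeff₂ v i (i.succAbove j) =
      (-1) ^ (i : ℕ) * relCoeff (fun k => v (i.succAbove k)) j := by
  rw [relCoeff₂, Matrix.det_succ_column_zero, Finset.sum_eq_single i]
  · simp only [Matrix.of_apply, Fin.cons_zero, Pi.single_eq_same, mul_one, relCoeff]
    congr 2
    ext k c
    refine Fin.cases ?_ (fun c => ?_) c
    · simp [Pi.single_apply]
    · simp
  · intro k _ hk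
    simp [Pi.single_eq_of_ne hk]
  · simp

theorem sum_relCoeff₂_smul (v : Fin (n + 2) → Fin n → K) (i : Fin (n + 2)) :
    ∑ j, relCoeff₂ v i j • v j = 0 := by
  rw [Fin.sum_univ_succAbove _ i, relCoeff₂_self, zero_smul, zero_add]
  simp_rw [relCoeff₂_succAbove, mul_smul]
  rw [← Finset.smul_sum, sum_relCoeff_smul, smul_zero]

/-- The Plücker relation. -/
theorem relCoeff₂_plucker (v : Fin (n + 2) → Fin n → K)
    (h : LinearIndependent K fun k : Fin n => v k.succ.succ) (i j : Fin (n + 2)) :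
    relCoeff₂ v 0 1 * relCoeff₂ v i j =
      relCoeff₂ v 0 i * relCoeff₂ v 1 j - relCoeff₂ v 1 i * relCoeff₂ v 0 j := by
  -- As a function of `j`, the difference of the two sides is a combination of linear relations,
  -- hence a relation. It vanishes at `0` and `1`, so it only involves the `n` remaining independent
  -- vectors and must be zero.
  set r : Fin (n + 2) → K := fun j => relCoeff₂ v 0 1 * relCoeff₂ v i j -
    relCoeff₂ v 0 i * relCoeff₂ v 1 j + relCoeff₂ v 1 i * relCoeff₂ v 0 j with hr
  have hsum : ∑ j, r j • v j = 0 := by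
    simp only [hr, add_smul, sub_smul, mul_smul, Finset.sum_add_distrib, Finset.sum_sub_distrib]
    simp only [← Finset.smul_sum, sum_relCoeff₂_smul]
    simp
  have h0 : r 0 = 0 := by
    simp only [hr, relCoeff₂_self]
    rw [relCoeff₂_antisymm v 0 i, relCoeff₂_antisymm v 0 1]
    ring
  have h1 : r 1 = 0 := by
    simp only [hr, relCoeff₂_self]
    rw [relCoeff₂_antisymm v 1 i]
    ring
  rw [Fin.sum_univ_succ, Fin.sum_univ_succ, h0, Fin.succ_zero_eq_one, h1, zero_smul, zero_smul,
    zero_add, zero_add] at hsum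
  have hr0 : r j = 0 := by
    refine Fin.cases h0 (fun j => Fin.cases h1 (fun j => ?_) j) j
    exact Fintype.linearIndependent_iff.1 h _ hsum j
  simp only [hr] at hr0
  linear_combination hr0

end RelationCoefficients

/-! ### The cocycle identity by a rotating line -/

section RotatingLine

/-- Splitting the full sum at `L` and reflecting the upper part expresses it as the difference of
the two partial sums. Splitting at `m - L` gives the opposite difference, so that difference is
zero. -/
theorem sum_range_reflect_antisymm {m : ℕ} {w : ℕ → ℤ} (hw : ∀ k < m, w (m - 1 - k) = -w k)
    {L : ℕ} (hL : L ≤ m) : ∑ k ∈ Finset.range (m - L), w k = ∑ k ∈ Finset.range L, w k := by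
  have key : ∀ L ≤ m, ∑ k ∈ Finset.range m, w k =
      ∑ k ∈ Finset.range L, w k - ∑ k ∈ Finset.range (m - L), w k := by
    intro L hL
    conv_lhs => rw [← Nat.add_sub_cancel' hL, Finset.sum_range_add]
    rw [← Finset.sum_range_reflect (fun k => w (L + k)), sub_eq_add_neg, ← Finset.sum_neg_distrib]
    congr 1
    refine Finset.sum_congr rfl fun k hk => ?_
    rw [Finset.mem_range] at hk
    rw [← hw k (by omega)]
    congr 1
    omega
  have h1 := key L hL
  have h2 := key (m - L) (Nat.sub_le _ _)
  rw [Nat.sub_sub_self hL] at h2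
  linarith

/-- Combinatorial form of the rotating line argument: `ε` records the side on which each of `m`
vectors, ordered by slope, lies. -/
theorem sum_orientation_counts {m : ℕ} {w : ℕ → ℤ} (hw : ∀ k < m, w (m - 1 - k) = -w k)
    (ε : Fin m → Bool) :
    ∑ i, w (Finset.univ.filter fun j => (i < j ∧ ε i ≠ ε j) ∨ (j < i ∧ ε i = ε j)).card = 0 := by
  -- `S k` is the set of vectors on the positive side once the line has swept past the first `k` of
  -- them: those already passed have changed sides. `H` evaluates a primitive of `w` at its size.
  let S : ℕ → Finset (Fin m) := fun k =>
    Finset.univ.filter fun j => if k ≤ j.val then ε j = true else ε j = false 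
  let H : ℕ → ℤ := fun k => ∑ l ∈ Finset.range (S k).card, w l
  have hstep : ∀ i : Fin m,
      w (Finset.univ.filter fun j => (i < j ∧ ε i ≠ ε j) ∨ (j < i ∧ ε i = ε j)).card =
        H (i + 1) - H i := by
    intro i
    cases hi : ε i with
    | false =>
      have h1 : (Finset.univ.filter fun j => (i < j ∧ false ≠ ε j) ∨ (j < i ∧ false = ε j)) =
          S i := by
        ext j
        by_cases hji : j = i
        · subst hji; simp [S, hi]
        · have := Fin.val_ne_of_ne hji
          simp only [S, Finset.mem_filter, Finset.mem_univ, true_and, Fin.lt_def]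
          cases ε j <;> simp <;> omega
      have h2 : S (i + 1) = insert i (S i) := by
        ext j
        by_cases hji : j = i
        · subst hji; simp [S, hi]
        · have := Fin.val_ne_of_ne hji
          simp only [S, Finset.mem_insert, Finset.mem_filter, Finset.mem_univ, true_and, hji,
            false_or]
          cases ε j <;> simp <;> omega
      have h3 : i ∉ S i := by simp [S, hi]
      rw [h1]
      simp only [H]
      rw [h2, Finset.card_insert_of_notMem h3, Finset.sum_range_succ]
      ring
    | true =>
      have h1 : (Finset.univ.filter fun j => (i < j ∧ true ≠ ε j) ∨ (j < i ∧ true = ε j)) =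
          (S i)ᶜ := by
        ext j
        by_cases hji : j = i
        · subst hji; simp [S, hi]
        · have := Fin.val_ne_of_ne hji
          simp only [S, Finset.mem_compl, Finset.mem_filter, Finset.mem_univ, true_and, Fin.lt_def]
          cases ε j <;> simp <;> omega
      have h2 : S i = insert i (S (i + 1)) := by
        ext j
        by_cases hji : j = i
        · subst hji; simp [S, hi]
        · have := Fin.val_ne_of_ne hji
          simp only [S, Finset.mem_insert, Finset.mem_filter, Finset.mem_univ, true_and, hji,
            false_or]
          cases ε j <;> simp <;> omega
      have h3 : i ∉ S (i + 1) := by simp [S, hi]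
      have h4 : (S i).card = (S (i + 1)).card + 1 := by
        rw [h2, Finset.card_insert_of_notMem h3]
      have h5 : (S i).card ≤ m := by simpa using Finset.card_le_univ (S i)
      rw [h1, Finset.card_compl, Fintype.card_fin]
      simp only [H]
      -- Here `i` leaves the positive side, so the count is the size of the complement of `S i`;
      -- antisymmetry turns its weight into minus the last term of `H i`.
      rw [h4, Finset.sum_range_succ, show m - ((S (i + 1)).card + 1) = m - 1 - (S (i + 1)).card by
        omega, hw _ (by omega)]
      ring
  rw [Finset.sum_congr rfl fun i _ => hstep i,
    Fin.sum_univ_eq_sum_range (fun i => H (i + 1) - H i), Finset.sum_range_sub, sub_eq_zero]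
  -- Half a turn exchanges the two sides, so the telescoped sum compares `H` at complementary sizes.
  have hm : S m = (S 0)ᶜ := by
    ext j
    simp [S, j.isLt.not_ge]
  simp only [H]
  rw [hm, Finset.card_compl, Fintype.card_fin]
  exact sum_range_reflect_antisymm hw (by simpa using Finset.card_le_univ (S 0))

variable {K : Type*} [Field K] [LinearOrder K] {n : ℕ}

/-- The number of negative coefficients in the linear relation between `n + 1` vectors. -/
def negCount (v : Fin (n + 1) → Fin n → K) : ℕ :=
  (Finset.univ.filter fun i => relCoeff v i < 0).card

theorem negCount_le (v : Fin (n + 1) → Fin n → K) : negCount v ≤ n + 1 :=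
  (Finset.card_le_univ _).trans_eq (Fintype.card_fin _)

theorem card_relCoeff_pos {v : Fin (n + 1) → Fin n → K} (h : ∀ i, relCoeff v i ≠ 0) :
    (Finset.univ.filter fun i => 0 < relCoeff v i).card = n + 1 - negCount v := by
  have hc := Finset.card_compl (Finset.univ.filter fun i => relCoeff v i < 0)
  rw [Fintype.card_fin] at hc
  rw [negCount, ← hc]
  congr 1
  ext i
  simp [(h i).symm.le_iff_lt]

variable [IsStrictOrderedRing K]

/-- The expression `x i * x j * (t j - t i)` is the determinant of the plane vectors `x i • (1, t
i)` and `x j • (1, t j)`. Sorting by the slope `t`, with the sign of `x` as the side, reduces to the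
combinatorial form. -/
theorem sum_slope_counts {m : ℕ} {w : ℕ → ℤ} (hw : ∀ k < m, w (m - 1 - k) = -w k)
    {x t : Fin m → K} (hx : ∀ i, x i ≠ 0) (ht : Function.Injective t) :
    ∑ i, w (Finset.univ.filter fun j => x i * x j * (t j - t i) < 0).card = 0 := by
  set σ := Tuple.sort t
  have hmono : StrictMono (t ∘ σ) :=
    (Tuple.monotone_sort t).strictMono_of_injective (ht.comp σ.injective)
  rw [← sum_orientation_counts hw fun i => decide (0 < x (σ i))]
  rw [← Equiv.sum_comp σ]
  refine Finset.sum_congr rfl fun i _ => ?_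
  congr 1
  have h : (Finset.univ.filter fun j => x (σ i) * x j * (t j - t (σ i)) < 0) =
      (Finset.univ.filter fun j => (i < j ∧ decide (0 < x (σ i)) ≠ decide (0 < x (σ j))) ∨
        (j < i ∧ decide (0 < x (σ i)) = decide (0 < x (σ j)))).map σ.toEmbedding := by
    ext j
    obtain ⟨j, rfl⟩ := σ.surjective j
    simp only [Finset.mem_filter, Finset.mem_univ, true_and, Finset.mem_map_equiv,
      Equiv.symm_apply_apply]
    rcases lt_trichotomy i j with h | h | h
    · have hlt : 0 < t (σ j) - t (σ i) := sub_pos.2 (hmono h)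
      rw [mul_neg_iff]
      rcases (hx (σ i)).lt_or_gt with hi | hi <;> rcases (hx (σ j)).lt_or_gt with hj | hj <;>
        simp only [mul_pos_iff, mul_neg_iff, h, h.not_gt, hi, hj, hi.not_gt, hj.not_gt, hlt,
          hlt.not_gt] <;> simp
    · subst h; simp
    · have hlt : t (σ j) - t (σ i) < 0 := sub_neg.2 (hmono h)
      rw [mul_neg_iff]
      rcases (hx (σ i)).lt_or_gt with hi | hi <;> rcases (hx (σ j)).lt_or_gt with hj | hj <;>
        simp only [mul_pos_iff, mul_neg_iff, h, h.not_gt, hi, hj, hi.not_gt, hj.not_gt, hlt,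
          hlt.not_gt] <;> simp
  rw [h, Finset.card_map]

/-- Gale duality: rows `0` and `1` of the minors attach to each index a vector of the plane, and by
the Plücker relation `relCoeff₂ v i j` is proportional to the determinant of the vectors at `i` and
`j`. -/
theorem sum_relCoeff₂_counts {w : ℕ → ℤ} (hw : ∀ k < n + 2, w (n + 1 - k) = -w k)
    {v : Fin (n + 2) → Fin n → K}
    (hv : ∀ f : Fin n → Fin (n + 2), Function.Injective f → LinearIndependent K fun k => v (f k)) :
    ∑ i, w (Finset.univ.filter fun j => relCoeff₂ v i j < 0).card = 0 := by
  have hne : ∀ i j, i ≠ j → relCoeff₂ v i j ≠ 0 := by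
    intro i j hij
    obtain ⟨j, rfl⟩ := Fin.exists_succAbove_eq hij.symm
    rw [relCoeff₂_succAbove]
    exact mul_ne_zero (pow_ne_zero _ (by simp)) (relCoeff_ne_zero (hv _
      (Fin.succAbove_right_injective.comp Fin.succAbove_right_injective)))
  -- A shear by `c` makes all first coordinates `x i` non-zero, so that slopes exist. At `i = 1` the
  -- quotient has denominator `0`; its default value merely excludes one more `c`, and that index is
  -- treated separately.
  obtain ⟨c, hc⟩ := Infinite.exists_notMem_finset
    (Finset.univ.image fun i => -relCoeff₂ v 0 i / relCoeff₂ v 1 i)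
  set x : Fin (n + 2) → K := fun i => relCoeff₂ v 0 i + c * relCoeff₂ v 1 i with hxdef
  have hx : ∀ i, x i ≠ 0 := by
    intro i hi
    by_cases h1 : relCoeff₂ v 1 i = 0
    · by_cases hi1 : i = 1
      · subst hi1
        simp only [hxdef, h1, mul_zero, add_zero] at hi
        exact hne 0 1 (by simp) hi
      · exact hne 1 i (Ne.symm hi1) h1
    · refine hc (Finset.mem_image.2 ⟨i, Finset.mem_univ _, ?_⟩)
      rw [div_eq_iff h1]
      simp only [hxdef] at hi
      linear_combination -hi
  -- The extra factor `relCoeff₂ v 0 1` in the slope makes the proportionality constant in `hE` a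
  -- square, hence positive.
  set t : Fin (n + 2) → K := fun i => relCoeff₂ v 0 1 * (relCoeff₂ v 1 i / x i) with htdef
  have hE : ∀ i j, relCoeff₂ v 0 1 ^ 2 * relCoeff₂ v i j = x i * x j * (t j - t i) := by
    intro i j
    have hp := relCoeff₂_plucker v (hv (fun k => k.succ.succ)
      ((Fin.succ_injective _).comp (Fin.succ_injective _))) i j
    have hi := hx i
    have hj := hx j
    simp only [htdef]
    field_simp
    simp only [hxdef]
    linear_combination relCoeff₂ v 0 1 * hp
  have h01 : 0 < relCoeff₂ v 0 1 ^ 2 := sq_pos_of_ne_zero (hne 0 1 (by simp))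
  rw [← sum_slope_counts (m := n + 2) (w := w) hw hx (t := t)]
  · refine Finset.sum_congr rfl fun i _ => ?_
    congr 2
    ext j
    simp only [Finset.mem_filter, Finset.mem_univ, true_and]
    rw [← hE, mul_neg_iff]
    simp [h01, h01.not_gt]
  · intro i j hij
    by_contra hne'
    refine (mul_ne_zero h01.ne' (hne i j hne')) ?_
    rw [hE, hij]
    simp

/-- The function `w` of the number of negative coefficients is a cocycle, as soon as it is
antisymmetric. -/
theorem sum_negCount_face {w : ℕ → ℤ} (hw : ∀ k < n + 2, w (n + 1 - k) = -w k)
    {v : Fin (n + 2) → Fin n → K}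
    (hv : ∀ f : Fin n → Fin (n + 2), Function.Injective f → LinearIndependent K fun k => v (f k)) :
    ∑ i : Fin (n + 2), (-1) ^ (i : ℕ) * w (negCount fun k => v (i.succAbove k)) = 0 := by
  rw [← sum_relCoeff₂_counts hw hv]
  refine Finset.sum_congr rfl fun i _ => ?_
  have hne : ∀ j, relCoeff (fun k => v (i.succAbove k)) j ≠ 0 := fun j =>
    relCoeff_ne_zero (hv _ (Fin.succAbove_right_injective.comp Fin.succAbove_right_injective))
  have h1 : (Finset.univ.filter fun j => relCoeff₂ v i j < 0) =
      (Finset.univ.filter fun j => (-1) ^ (i : ℕ) * relCoeff (fun k => v (i.succAbove k)) j < 0).map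
        i.succAboveEmb := by
    ext j
    rcases Fin.eq_self_or_eq_succAbove i j with rfl | ⟨j, rfl⟩
    · simp [relCoeff₂_self, Fin.succAbove_ne]
    · simp [relCoeff₂_succAbove]
  rw [h1, Finset.card_map]
  -- For odd `i` the sign exchanges negative and positive coefficients of the face, and antisymmetry
  -- of `w` produces exactly the sign in the boundary.
  rcases Nat.even_or_odd (i : ℕ) with hi | hi
  · simp only [hi.neg_one_pow, one_mul, negCount]
  · simp only [hi.neg_one_pow, neg_mul, one_mul, neg_lt_zero]
    rw [card_relCoeff_pos hne, hw _ (by have := negCount_le fun k => v (i.succAbove k); omega)]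

end RotatingLine

/-! ### Comparison maps and naturality of classes -/

section Comparison

variable {R G H : Type u} [CommRing R] [Group G] [Group H]

/-- Chain maps from the bar resolution to an acyclic complex which agree on augmentations are
homotopic. -/
theorem nonempty_homotopy_bar (C : AcyclicGComplex R G) (e : Rep.barComplex R G ⟶ C.complex)
    (he : e.f 0 ≫ C.aug = 0) : Nonempty (Homotopy e 0) := by
  obtain ⟨zero, hzero⟩ := exists_lift (e.f 0) (C.complex.d 1 0) fun a => C.exact_zero _
    (congrArg (fun f => f.hom (Finsupp.single a (.single 1 1))) he)
  obtain ⟨one, hone⟩ := exists_lift (e.f 1 - (Rep.barComplex R G).d 1 0 ≫ zero)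
    (C.complex.d 2 1) fun a => C.exact_succ 0 _ (by
      have : (e.f 1 - (Rep.barComplex R G).d 1 0 ≫ zero) ≫ C.complex.d 1 0 = 0 := by
        rw [Preadditive.sub_comp, Category.assoc, hzero, e.comm, sub_self]
      exact congrArg (fun f => f.hom (Finsupp.single a (.single 1 1))) this)
  refine ⟨Homotopy.mkInductive e zero hzero.symm one (by rw [hone]; abel) fun n p => ?_⟩
  have hp : p.2.1 ≫ C.complex.d (n + 2) (n + 1) =
      e.f (n + 1) - (Rep.barComplex R G).d (n + 1) n ≫ p.1 := by
    rw [eq_sub_iff_add_eq', ← p.2.2]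
  have hex := exists_lift (e.f (n + 2) - (Rep.barComplex R G).d (n + 2) (n + 1) ≫ p.2.1)
    (C.complex.d (n + 3) (n + 2)) fun a => C.exact_succ (n + 1) _ (by
      have : (e.f (n + 2) - (Rep.barComplex R G).d (n + 2) (n + 1) ≫ p.2.1) ≫
          C.complex.d (n + 2) (n + 1) = 0 := by
        rw [Preadditive.sub_comp, Category.assoc, hp, e.comm, Preadditive.comp_sub,
          HomologicalComplex.d_comp_d_assoc, Limits.zero_comp, sub_zero, sub_self]
      exact congrArg (fun f => f.hom (Finsupp.single a (.single 1 1))) this)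
  exact ⟨hex.choose, by rw [hex.choose_spec]; abel⟩

/-- The inhomogeneous cochain of a homomorphism out of a term of the bar resolution. -/
noncomputable def barCochain {A : Rep.{u} R G} {d : ℕ} (φ : Rep.free R G (Fin d → G) ⟶ A) :
    (Fin d → G) → A :=
  fun g => φ.hom (Finsupp.single g (.single 1 1))

/-- Under the universal property of free modules, the cochain differential is precomposition with
the bar differential; this is how a homotopy of chain maps becomes a coboundary. -/
theorem d_barCochain {A : Rep.{u} R G} {d : ℕ} (φ : Rep.free R G (Fin d → G) ⟶ A) :
    inhomogeneousCochains.d A d (barCochain φ) = barCochain (Rep.barComplex.d R G d ≫ φ) := by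
  have h1 : (Rep.freeLiftLEquiv R G (Fin d → G) A).symm (barCochain φ) = φ :=
    (Rep.freeLiftLEquiv R G (Fin d → G) A).symm_apply_apply φ
  rw [inhomogeneousCochains.d_eq]
  change Rep.freeLiftLEquiv R G (Fin (d + 1) → G) A ((Rep.barComplex R G).d (d + 1) d ≫
    (Rep.freeLiftLEquiv R G (Fin d → G) A).symm (barCochain φ)) = _
  rw [h1, Rep.barComplex.d_def]
  rfl

theorem π_cocyclesMk_eq {A : Rep.{u} R G} {d : ℕ} {f f' : (Fin (d + 1) → G) → A}
    (hf : inhomogeneousCochains.d A (d + 1) f = 0)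
    (hf' : inhomogeneousCochains.d A (d + 1) f' = 0) (x : (Fin d → G) → A)
    (hx : f - f' = inhomogeneousCochains.d A d x) :
    groupCohomology.π A (d + 1) (groupCohomology.cocyclesMk f hf) =
      groupCohomology.π A (d + 1) (groupCohomology.cocyclesMk f' hf') := by
  rw [← sub_eq_zero, ← map_sub]
  have : groupCohomology.cocyclesMk f hf - groupCohomology.cocyclesMk f' hf' =
      groupCohomology.toCocycles A d (d + 1) x := by
    apply (ModuleCat.mono_iff_injective (groupCohomology.iCocycles A (d + 1))).1 inferInstance
    rw [map_sub, groupCohomology.iCocycles_mk, groupCohomology.iCocycles_mk]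
    have h := (groupCohomology.inhomogeneousCochains A).toCycles_i d (d + 1)
    rw [groupCohomology.inhomogeneousCochains.d_def] at h
    exact hx.trans (congrArg (fun k => k.hom x) h).symm
  rw [this]
  have h := (groupCohomology.inhomogeneousCochains A).toCycles_comp_homologyπ d (d + 1)
  exact congrArg (fun k => k.hom x) h

/-- Any two comparison maps are homotopic and `T` kills boundaries, so the cochains differ by the
coboundary of the homotopy followed by `T`. The degree is positive because that homotopy starts one
degree lower. -/
theorem classOfCocycle_eq (C : AcyclicGComplex R G) {A : Rep.{u} R G} {d : ℕ}
    (T : C.complex.X (d + 1) ⟶ A) (hT : C.complex.d (d + 2) (d + 1) ≫ T = 0)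
    (ψ : Rep.barComplex R G ⟶ C.complex) (hψ : ψ.f 0 ≫ C.aug = barAug R G)
    (f : (Fin (d + 1) → G) → A) (hf : f = barCochain (ψ.f (d + 1) ≫ T))
    (hf' : inhomogeneousCochains.d A (d + 1) f = 0) :
    groupCohomology.π A (d + 1) (groupCohomology.cocyclesMk f hf') = classOfCocycle C T hT := by
  obtain ⟨h⟩ := nonempty_homotopy_bar C (ψ - comparison C) (by
    rw [HomologicalComplex.sub_f_apply, Preadditive.sub_comp, hψ, comparison_aug, sub_self])
  have hc : ψ.f (d + 1) - (comparison C).f (d + 1) =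
      (Rep.barComplex R G).d (d + 1) d ≫ h.hom d (d + 1) +
        h.hom (d + 1) (d + 2) ≫ C.complex.d (d + 2) (d + 1) := by
    have := h.comm (d + 1)
    rwa [dNext_eq h.hom (show (ComplexShape.down ℕ).Rel (d + 1) d from rfl),
      prevD_eq h.hom (show (ComplexShape.down ℕ).Rel (d + 2) (d + 1) from rfl),
      HomologicalComplex.zero_f, add_zero, HomologicalComplex.sub_f_apply] at this
  refine π_cocyclesMk_eq _ _ (barCochain (h.hom d (d + 1) ≫ T)) ?_
  have hT' : Rep.barComplex.d R G d ≫ h.hom d (d + 1) ≫ T =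
      ψ.f (d + 1) ≫ T - (comparison C).f (d + 1) ≫ T := by
    rw [← Preadditive.sub_comp, hc, Preadditive.add_comp, Category.assoc, Category.assoc, hT,
      Limits.comp_zero, add_zero, Rep.barComplex.d_def]
  rw [d_barCochain, hT', hf]
  rfl

theorem map_cocyclesMk (φ : G →* H) {A : Rep.{u} R H} {B : Rep.{u} R G} (p : Rep.res φ A ⟶ B)
    {d : ℕ} (f : (Fin d → H) → A) (hf : inhomogeneousCochains.d A d f = 0) :
    ∃ hf', groupCohomology.map φ p d (groupCohomology.π A d (groupCohomology.cocyclesMk f hf)) =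
      groupCohomology.π B d (groupCohomology.cocyclesMk (fun g => p.hom (f (φ ∘ g))) hf') := by
  have hf' : inhomogeneousCochains.d B d (fun g => p.hom (f (φ ∘ g))) = 0 := by
    have h := (groupCohomology.cochainsMap φ p).comm d (d + 1)
    rw [groupCohomology.inhomogeneousCochains.d_def,
      groupCohomology.inhomogeneousCochains.d_def] at h
    have h2 := congrArg (fun k => k.hom f) h
    refine h2.trans ?_
    change (groupCohomology.cochainsMap φ p).f (d + 1) (inhomogeneousCochains.d A d f) = 0
    rw [hf, map_zero]
  refine ⟨hf', ?_⟩
  rw [groupCohomology.π_map_apply]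
  congr 1
  apply (ModuleCat.mono_iff_injective (groupCohomology.iCocycles B d)).1 inferInstance
  rw [groupCohomology.iCocycles_mk]
  have h := HomologicalComplex.cyclesMap_i (groupCohomology.cochainsMap φ p) d
  refine (congrArg (fun k => k.hom (groupCohomology.cocyclesMk f hf)) h).trans ?_
  change (groupCohomology.cochainsMap φ p).f d
    (groupCohomology.iCocycles A d (groupCohomology.cocyclesMk f hf)) = _
  rw [groupCohomology.iCocycles_mk]
  rfl

/-- The chain map of bar resolutions induced by a group homomorphism, in one degree. -/
noncomputable def barMap (R : Type u) [CommRing R] (φ : G →* H) (d : ℕ) :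
    (Representation.free R G (Fin d → G)).IntertwiningMap
      ((Representation.free R H (Fin d → H)).comp φ) :=
  Representation.freeLift _ fun g => Finsupp.single (φ ∘ g) (.single 1 1)

theorem barMap_single (φ : G →* H) (d : ℕ) (g : Fin d → G) (x : G) (r : R) :
    barMap R φ d (Finsupp.single g (.single x r)) = Finsupp.single (φ ∘ g) (.single (φ x) r) := by
  rw [barMap, Representation.freeLift_single_single]
  simp

theorem barMap_d_single (φ : G →* H) (d : ℕ) (g : Fin (d + 1) → G) :
    (Rep.barComplex.d R H d).hom (Finsupp.single (φ ∘ g) (.single 1 1)) =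
      barMap R φ d ((Rep.barComplex.d R G d).hom (Finsupp.single g (.single 1 1))) := by
  rw [Rep.barComplex.d_single, Rep.barComplex.d_single, map_add, map_sum, barMap_single]
  congr 1
  refine Finset.sum_congr rfl fun i _ => ?_
  rw [barMap_single, map_one, Fin.comp_contractNth _ (· * ·) fun _ _ => map_mul φ _ _]

/-- The restriction of an acyclic complex along a group homomorphism. -/
noncomputable def AcyclicGComplex.restrict (D : AcyclicGComplex R H) (φ : G →* H) :
    AcyclicGComplex R G where
  complex := ((Rep.resFunctor φ).mapHomologicalComplex _).obj D.complex
  aug := (Rep.resFunctor φ).map D.aug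
  aug_d := D.aug_d
  aug_surjective := D.aug_surjective
  exact_zero := D.exact_zero
  exact_succ := D.exact_succ

/-- The comparison map of `D`, pulled back to the bar resolution of `G`. -/
noncomputable def pullbackComparison (D : AcyclicGComplex R H) (φ : G →* H) :
    Rep.barComplex R G ⟶ (D.restrict φ).complex where
  f d := Rep.ofHom (barMap R φ d) ≫ (Rep.resFunctor φ).map ((comparison D).f d)
  comm' := by
    rintro i j (rfl : j + 1 = i)
    rw [Rep.barComplex.d_def]
    refine Rep.free_ext _ _ _ _ _ fun g => ?_
    change (D.complex.d (j + 1) j).hom (((comparison D).f (j + 1)).hom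
      (barMap R φ (j + 1) (Finsupp.single g (.single 1 1)))) = ((comparison D).f j).hom
        (barMap R φ j ((Rep.barComplex.d R G j).hom (Finsupp.single g (.single 1 1))))
    rw [← barMap_d_single, barMap_single, map_one]
    have h := (comparison D).comm (j + 1) j
    rw [Rep.barComplex.d_def] at h
    exact congrArg (fun k => k.hom (Finsupp.single (φ ∘ g) (.single 1 1))) h

theorem pullbackComparison_aug (D : AcyclicGComplex R H) (φ : G →* H) :
    (pullbackComparison D φ).f 0 ≫ (D.restrict φ).aug = barAug R G := by
  refine Rep.free_ext _ _ _ _ _ fun g => ?_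
  change D.aug.hom (((comparison D).f 0).hom (barMap R φ 0 (Finsupp.single g (.single 1 1)))) = _
  rw [barMap_single, map_one]
  have h := congrArg (fun k => k.hom (Finsupp.single (φ ∘ g) (.single 1 1))) (comparison_aug D)
  refine h.trans ?_
  change Representation.freeLift (Representation.trivial R H R) (fun _ : Fin 0 → H => (1 : R)) _ =
    Representation.freeLift (Representation.trivial R G R) (fun _ : Fin 0 → G => (1 : R)) _
  rw [Representation.freeLift_single_single, Representation.freeLift_single_single]
  simp

variable {A : Type u} [AddCommGroup A] [Module R A]

/-- Naturality of the class of a cocycle with trivial coefficients, for an equivariant chain map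
`p` over a group homomorphism `φ`. -/
theorem pullback_classOfCocycle (φ : G →* H) (C : AcyclicGComplex R G) (D : AcyclicGComplex R H)
    (p : C.complex ⟶ (D.restrict φ).complex) (hp : p.f 0 ≫ (D.restrict φ).aug = C.aug) {d : ℕ}
    (S : C.complex.X (d + 1) ⟶ Rep.trivial R G A) (hS : C.complex.d (d + 2) (d + 1) ≫ S = 0)
    (T : D.complex.X (d + 1) ⟶ Rep.trivial R H A) (hT : D.complex.d (d + 2) (d + 1) ≫ T = 0)
    (hST : ∀ x, S.hom x = T.hom ((p.f (d + 1)).hom x)) :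
    pullback φ A (d + 1) (classOfCocycle D T hT) = classOfCocycle C S hS := by
  let T' : (D.restrict φ).complex.X (d + 1) ⟶ Rep.trivial R G A := (Rep.resFunctor φ).map T
  have hT' : (D.restrict φ).complex.d (d + 2) (d + 1) ≫ T' = 0 := by
    refine Rep.hom_ext (Representation.IntertwiningMap.ext (LinearMap.ext fun x => ?_))
    exact congrArg (fun k => k.hom x) hT
  obtain ⟨h1, h2⟩ := map_cocyclesMk φ (B := Rep.trivial R G A) (A := Rep.trivial R H A)
    (Rep.ofHom (ρ := Representation.trivial R G A) (σ := Representation.trivial R G A)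
      ⟨LinearMap.id, fun _ => rfl⟩) (barCochain ((comparison D).f (d + 1) ≫ T)) (bar_cocycle _ (by
        rw [← Rep.barComplex.d_def, ← Category.assoc, ← (comparison D).comm,
          Category.assoc, hT, Limits.comp_zero]))
  have hψ : ((comparison C ≫ p).f 0) ≫ (D.restrict φ).aug = barAug R G := by
    rw [HomologicalComplex.comp_f, Category.assoc, hp, comparison_aug]
  have hS' : (comparison C).f (d + 1) ≫ S = (comparison C ≫ p).f (d + 1) ≫ T' := by
    refine Rep.hom_ext (Representation.IntertwiningMap.ext (LinearMap.ext fun x => ?_))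
    exact hST _
  -- Both sides are the class of `T'` on the restricted complex, computed with two comparison maps:
  -- the pulled back comparison of `D`, and the comparison of `C` followed by `p`.
  refine h2.trans ((classOfCocycle_eq (A := Rep.trivial R G A) (D.restrict φ) T' hT'
    (pullbackComparison D φ) (pullbackComparison_aug D φ) _ ?_ h1).trans
    (classOfCocycle_eq (A := Rep.trivial R G A) (D.restrict φ) T' hT' (comparison C ≫ p) hψ _
      (congrArg barCochain hS') ?_).symm)
  · funext g
    change T.hom (((comparison D).f (d + 1)).hom _) =
      T.hom (((comparison D).f (d + 1)).hom (barMap R φ (d + 1) _))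
    rw [barMap_single, map_one]
  · exact bar_cocycle _ (by
      rw [← Rep.barComplex.d_def, ← Category.assoc, ← (comparison C).comm, Category.assoc, hS,
        Limits.comp_zero])

theorem coeffMap_classOfCocycle {B : Type u} [AddCommGroup B] [Module R B]
    (C : AcyclicGComplex R G) (f : A →ₗ[R] B) {d : ℕ}
    (T : C.complex.X d ⟶ Rep.trivial R G A) (hT : C.complex.d (d + 1) d ≫ T = 0)
    (S : C.complex.X d ⟶ Rep.trivial R G B) (hS : C.complex.d (d + 1) d ≫ S = 0)
    (h : ∀ x, S.hom x = f (T.hom x)) :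
    coeffMap f d (classOfCocycle C T hT) = classOfCocycle C S hS := by
  obtain ⟨h1, h2⟩ := map_cocyclesMk (MonoidHom.id G)
    (B := Rep.trivial R G B) (A := Rep.trivial R G A)
    (Rep.ofHom (ρ := Representation.trivial R G A) (σ := Representation.trivial R G B)
      ⟨f, fun _ => rfl⟩) (barCochain ((comparison C).f d ≫ T)) (bar_cocycle _ (by
        rw [← Rep.barComplex.d_def, ← Category.assoc, ← (comparison C).comm,
          Category.assoc, hT, Limits.comp_zero]))
  refine h2.trans ?_
  rw [classOfCocycle]
  congr 2
  funext g
  exact (h _).symm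

/-- The cocycle with values in `A` given by a homomorphism from the coefficient group to `A`. -/
noncomputable def coeffCocycle (C : ChainComplex (Rep.{u} R G) ℕ) (d : ℕ) (f : Coeff C d →ₗ[R] A) :
    C.X d ⟶ Rep.trivial R G A :=
  tautologicalCocycle C d ≫ Rep.ofHom (ρ := Representation.trivial R G (Coeff C d))
    (σ := Representation.trivial R G A) ⟨f, fun _ => rfl⟩

theorem d_coeffCocycle (C : ChainComplex (Rep.{u} R G) ℕ) (d : ℕ) (f : Coeff C d →ₗ[R] A) :
    C.d (d + 1) d ≫ coeffCocycle C d f = 0 := by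
  rw [coeffCocycle, ← Category.assoc, d_tautologicalCocycle, Limits.zero_comp]

theorem coeffMap_tautologicalClass (C : AcyclicGComplex R G) (d : ℕ)
    (f : Coeff C.complex d →ₗ[R] A) :
    coeffMap f d (tautologicalClass C d) =
      classOfCocycle C (coeffCocycle C.complex d f) (d_coeffCocycle C.complex d f) :=
  coeffMap_classOfCocycle _ _ _ _ _ _ fun _ => rfl

theorem coeffMap_sum {B : Type u} [AddCommGroup B] [Module R B] {ι : Type*} (s : Finset ι)
    (c : ι → ℤ) (f : ι → A →ₗ[R] B) (d : ℕ) (x : groupCohomology (Rep.trivial R G A) d) :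
    ∑ i ∈ s, c i • coeffMap (f i) d x = coeffMap (∑ i ∈ s, c i • f i) d x := by
  induction x using groupCohomology_induction_on with | h z =>
  have key : ∀ g : A →ₗ[R] B, coeffMap g d (groupCohomology.π (Rep.trivial R G A) d z) =
      groupCohomology.π (Rep.trivial R G B) d (groupCohomology.cocyclesMap (MonoidHom.id G)
        (B := Rep.trivial R G B) (A := Rep.trivial R G A)
        (Rep.ofHom (ρ := Representation.trivial R G A) (σ := Representation.trivial R G B)
          ⟨g, fun _ => rfl⟩) d z) := fun g =>
    groupCohomology.π_map_apply _ _ _ _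
  have hi : ∀ g : A →ₗ[R] B, groupCohomology.iCocycles (Rep.trivial R G B) d
      (groupCohomology.cocyclesMap (MonoidHom.id G)
        (B := Rep.trivial R G B) (A := Rep.trivial R G A)
        (Rep.ofHom (ρ := Representation.trivial R G A) (σ := Representation.trivial R G B)
          ⟨g, fun _ => rfl⟩) d z) =
      fun y => g ((groupCohomology.iCocycles (Rep.trivial R G A) d z : (Fin d → G) → A) y) :=
    fun g => congrArg (fun k => k.hom z) (HomologicalComplex.cyclesMap_i
      (groupCohomology.cochainsMap (MonoidHom.id G) (B := Rep.trivial R G B)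
        (A := Rep.trivial R G A) (Rep.ofHom (ρ := Representation.trivial R G A)
          (σ := Representation.trivial R G B) ⟨g, fun _ => rfl⟩)) d)
  simp only [key, ← map_zsmul, ← map_sum]
  congr 1
  -- Cocycles embed in cochains, where the coefficient map is composition with `g` and hence visibly
  -- additive in `g`.
  apply (ModuleCat.mono_iff_injective
    (groupCohomology.iCocycles (Rep.trivial R G B) d)).1 inferInstance
  rw [hi, map_sum]
  simp only [map_zsmul, hi]
  funext y
  refine (Finset.sum_apply (M := fun _ : Fin d → G => B) _ _ _).trans ?_
  simp

end Comparison

/-! ### Generators and universal property of the coefficient group -/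

section CoefficientGroup

variable {R G V : Type u} [CommRing R] [Group G] [MulAction G V] {X : GSimplicialComplex G V}
  {d : ℕ}

/-- The class of an ordered simplex in the coefficient group. -/
noncomputable def simplexClass (R : Type u) [CommRing R] (σ : OrderedSimplex X d) :
    Coeff (chainComplex R X) d :=
  toCoeff (chainComplex R X) d (chainOf R σ)

theorem simplexClass_permute (σ : OrderedSimplex X d) (t : Equiv.Perm (Fin (d + 1))) :
    simplexClass R (σ.permute t) = ((Equiv.Perm.sign t : ℤ) : R) • simplexClass R σ := by
  rw [simplexClass, chainOf_permute]
  exact map_smul _ _ _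

theorem simplexClass_eq_permute (σ : OrderedSimplex X d) (t : Equiv.Perm (Fin (d + 1))) :
    simplexClass R σ = ((Equiv.Perm.sign t : ℤ) : R) • simplexClass R (σ.permute t) := by
  rw [simplexClass_permute, smul_smul, ← Int.cast_mul]
  simp

theorem simplexClass_translate (g : G) (σ : OrderedSimplex X d) :
    simplexClass R (σ.translate g) = simplexClass R σ := by
  rw [simplexClass, ← chainAction_chainOf]
  exact Representation.Coinvariants.mk_self_apply (quotientAction (chainComplex R X) d) g
    ((boundaries (chainComplex R X) d).mkQ (chainOf R σ))

theorem span_simplexClass :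
    Submodule.span R (Set.range (simplexClass R : OrderedSimplex X d → _)) = ⊤ := by
  have h : Finsupp.linearCombination R (simplexClass R : OrderedSimplex X d → _) =
      (toCoeff (chainComplex R X) d : Chain R X d →ₗ[R] _) ∘ₗ (alternation R X d).mkQ :=
    Finsupp.lhom_ext' fun σ => LinearMap.ext_ring (by simp; rfl)
  rw [← Finsupp.range_linearCombination, LinearMap.range_eq_top, h]
  exact ((Representation.Coinvariants.mk_surjective _).comp (Submodule.mkQ_surjective _)).comp
    (Submodule.mkQ_surjective _)

/-- Homomorphisms out of the coefficient group are invariant alternating cocycles. -/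
noncomputable def coeffLift {M : Type*} [AddCommGroup M] [Module R M] (f : OrderedSimplex X d → M)
    (hf : ∀ σ t, f (σ.permute t) = ((Equiv.Perm.sign t : ℤ) : R) • f σ)
    (hG : ∀ g σ, f (σ.translate g) = f σ)
    (hd : ∀ σ : OrderedSimplex X (d + 1),
      ∑ i : Fin (d + 2), (-1 : R) ^ (i : ℕ) • f (σ.face i) = 0) :
    Coeff (chainComplex R X) d →ₗ[R] M :=
  Representation.Coinvariants.lift (quotientAction (chainComplex R X) d)
    ((boundaries (chainComplex R X) d).liftQ (chainLift f hf) (by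
      rintro _ ⟨x, rfl⟩
      rw [chainComplex_d]
      revert x
      refine LinearMap.congr_fun (f := chainLift f hf ∘ₗ boundary R X d) (g := 0) ?_
      refine chain_hom_ext fun σ => ?_
      rw [LinearMap.comp_apply, boundary_chainOf, map_sum]
      simpa using hd σ)) (fun g => by
      refine Submodule.linearMap_qext _ ?_
      refine chain_hom_ext (f := chainLift f hf ∘ₗ chainAction R X d g) fun σ => ?_
      rw [LinearMap.comp_apply, chainAction_chainOf, chainLift_chainOf, hG]
      exact (chainLift_chainOf f hf σ).symm)

@[simp] theorem coeffLift_simplexClass {M : Type*} [AddCommGroup M] [Module R M]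
    (f : OrderedSimplex X d → M)
    (hf : ∀ σ t, f (σ.permute t) = ((Equiv.Perm.sign t : ℤ) : R) • f σ)
    (hG : ∀ g σ, f (σ.translate g) = f σ)
    (hd : ∀ σ : OrderedSimplex X (d + 1),
      ∑ i : Fin (d + 2), (-1 : R) ^ (i : ℕ) • f (σ.face i) = 0) (σ : OrderedSimplex X d) :
    coeffLift f hf hG hd (simplexClass R σ) = f σ :=
  chainLift_chainOf f hf σ

end CoefficientGroup

/-! ### Count functionals on generic simplices -/

section GenericSimplices

variable {K P Γ : Type u} [Field K] {n : ℕ} [Group Γ] [MulAction Γ P] {rep : P → Fin n → K}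
  {rep_ne : ∀ p, rep p ≠ 0} {act : ∀ γ : Γ, ∃ L : (Fin n → K) ≃ₗ[K] (Fin n → K), ∀ p, ∃ c : K,
    c ≠ 0 ∧ rep (γ • p) = c • L (rep p)}

theorem linearIndependent_vertex {d : ℕ} (σ : OrderedSimplex (genericComplex rep rep_ne act) d)
    (f : Fin n → Fin (d + 1)) (hf : Function.Injective f) :
    LinearIndependent K fun k => rep (σ.vertex (f k)) := by
  have h := σ.mem_faces.2 (Finset.univ.map ((⟨f, hf⟩ : Fin n ↪ _).trans σ.vertex))
    (by rw [← Finset.map_map]; exact Finset.map_subset_map.2 (Finset.subset_univ _)) (by simp)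
  exact LinearIndependent.comp h (fun k => ⟨σ.vertex (f k), by simp⟩) fun k l hkl =>
    hf (σ.vertex.injective (Subtype.ext_iff.1 hkl))

theorem relCoeff_vertex_ne_zero (σ : OrderedSimplex (genericComplex rep rep_ne act) n)
    (i : Fin (n + 1)) : relCoeff (fun k => rep (σ.vertex k)) i ≠ 0 :=
  relCoeff_ne_zero (linearIndependent_vertex σ _ Fin.succAbove_right_injective)

variable [LinearOrder K]

variable [IsStrictOrderedRing K]

/-- An even permutation only relabels the relation, while an odd one also reverses all its signs and
so turns the count into `n + 1` minus itself. -/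
theorem apply_negCount_permute {w : ℕ → ℤ}
    (hw : ∀ k < n + 2, w (n + 1 - k) = -w k)
    {v : Fin (n + 1) → Fin n → K} (hv : ∀ i, relCoeff v i ≠ 0) (t : Equiv.Perm (Fin (n + 1))) :
    w (negCount (v ∘ t)) = (Equiv.Perm.sign t : ℤ) * w (negCount v) := by
  rcases Int.units_eq_one_or (Equiv.Perm.sign t) with ht | ht
  · have : negCount (v ∘ t) = negCount v := by
      rw [negCount, negCount, ← Finset.card_map t.toEmbedding]
      congr 1
      ext i
      simp [relCoeff_permute, ht]
    simp [this, ht]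
  · have : negCount (v ∘ t) = n + 1 - negCount v := by
      rw [← card_relCoeff_pos hv, negCount, ← Finset.card_map t.toEmbedding]
      congr 1
      ext i
      simp [relCoeff_permute, ht]
    rw [this, hw _ (by have := negCount_le v; omega), ht]
    simp

/-- The homomorphism on the coefficient group of a complex of generic points given by an
antisymmetric function of the number of negative coefficients. -/
noncomputable def countFunctional (w : ℕ → ℤ) (hw : ∀ k < n + 2, w (n + 1 - k) = -w k)
    (hG : ∀ (g : Γ) (σ : OrderedSimplex (genericComplex rep rep_ne act) n),
      w (negCount fun k => rep (g • σ.vertex k)) = w (negCount fun k => rep (σ.vertex k))) :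
    Coeff (chainComplex IntU.{u} (genericComplex rep rep_ne act)) n →ₗ[IntU.{u}] IntU.{u} :=
  coeffLift (fun σ => ((w (negCount fun k => rep (σ.vertex k)) : ℤ) : IntU.{u}))
    (fun σ t => by
      rw [smul_eq_mul, ← Int.cast_mul, ← apply_negCount_permute hw (relCoeff_vertex_ne_zero σ) t]
      rfl)
    (fun g σ => congrArg Int.cast (hG g σ))
    (fun σ => by
      have h := sum_negCount_face hw (v := fun k => rep (σ.vertex k))
        (linearIndependent_vertex σ)
      have h2 := congrArg (Int.cast : ℤ → IntU.{u}) h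
      push_cast at h2
      exact h2)

theorem countFunctional_simplexClass (w : ℕ → ℤ) (hw : ∀ k < n + 2, w (n + 1 - k) = -w k)
    (hG : ∀ (g : Γ) (σ : OrderedSimplex (genericComplex rep rep_ne act) n),
      w (negCount fun k => rep (g • σ.vertex k)) = w (negCount fun k => rep (σ.vertex k)))
    (σ : OrderedSimplex (genericComplex rep rep_ne act) n) :
    countFunctional w hw hG (simplexClass IntU.{u} σ) =
      ((w (negCount fun k => rep (σ.vertex k)) : ℤ) : IntU.{u}) :=
  coeffLift_simplexClass _ _ _ _ σ

end GenericSimplices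

/-! ### Standard tuples and invariance of the count -/

section Counting

variable {K : Type*} [Field K] {n : ℕ}

theorem relCoeff_last (hn : Even n) (v : Fin (n + 1) → Fin n → K) :
    relCoeff v (Fin.last n) = (Matrix.of fun k : Fin n => v k.castSucc).det := by
  rw [relCoeff_eq_minor, Fin.val_last, hn.neg_one_pow, one_mul]
  simp

theorem relCoeff_standardTuple_last (hn : Even n) (α : Fin n → K) :
    relCoeff (standardTuple α) (Fin.last n) = 1 := by
  rw [relCoeff_last hn, ← Matrix.det_one (n := Fin n)]
  congr 1
  ext i j
  simp [standardTuple, Matrix.one_apply, Pi.single_apply, eq_comm]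

/-- With last coefficient `1`, the only relation is `α - ∑ α k • e_k = 0`. -/
theorem relCoeff_standardTuple_castSucc (hn : Even n) (α : Fin n → K) (k : Fin n) :
    relCoeff (standardTuple α) k.castSucc = -α k := by
  have h := congrFun (sum_relCoeff_smul (standardTuple α)) k
  rw [Fin.sum_univ_castSucc, relCoeff_standardTuple_last hn] at h
  simp only [standardTuple, Pi.add_apply, Finset.sum_apply, Pi.smul_apply, Fin.snoc_castSucc,
    Fin.snoc_last, Pi.single_apply, smul_eq_mul, mul_ite, mul_one, mul_zero, one_mul,
    Finset.sum_ite_eq, Finset.mem_univ, if_true, Pi.zero_apply] at h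
  exact eq_neg_of_add_eq_zero_left h

/-- Every generic tuple is the image of a standard one, up to rescaling the vectors. -/
theorem exists_mulVec_standardTuple (hn : Even n) (v : Fin (n + 1) → Fin n → K) {α : Fin n → K}
    (hα : ∀ k, α k ≠ 0) : ∃ g : Matrix (Fin n) (Fin n) K,
      g.det = (∏ k : Fin n, -relCoeff v k.castSucc / α k) * relCoeff v (Fin.last n) ∧
      (∀ k : Fin n, g.mulVec (standardTuple α k.castSucc) =
        (-relCoeff v k.castSucc / α k) • v k.castSucc) ∧
      g.mulVec (standardTuple α (Fin.last n)) = relCoeff v (Fin.last n) • v (Fin.last n) := by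
  -- A matrix sending each `e_k` to `β k • v k` sends `α` to `∑ (α k * β k) • v k`. Taking `α k * β
  -- k = -relCoeff v k` makes this a multiple of the last vector, by the linear relation.
  set β : Fin n → K := fun k => -relCoeff v k.castSucc / α k with hβ
  refine ⟨(Matrix.diagonal β * Matrix.of fun k : Fin n => v k.castSucc).transpose, ?_, ?_, ?_⟩
  · rw [Matrix.det_transpose, Matrix.det_mul, Matrix.det_diagonal, relCoeff_last hn]
  · intro k
    ext l
    simp [standardTuple, Matrix.mulVec_single, hβ, mul_comm]
  · have h := sum_relCoeff_smul v
    rw [Fin.sum_univ_castSucc] at h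
    rw [← neg_eq_iff_add_eq_zero.2 h]
    ext l
    simp only [standardTuple, Fin.snoc_last, Matrix.mulVec, dotProduct, Matrix.transpose_apply,
      Matrix.diagonal_mul, Matrix.of_apply, Pi.neg_apply, Finset.sum_apply, Pi.smul_apply,
      smul_eq_mul]
    rw [← Finset.sum_neg_distrib]
    refine Finset.sum_congr rfl fun k _ => ?_
    have := hα k
    simp only [hβ]
    field_simp

variable [LinearOrder K] [IsStrictOrderedRing K]

theorem negCount_map_pos_smul {g : Matrix (Fin n) (Fin n) K} (hg : 0 < g.det)
    {c : Fin (n + 1) → K} (hc : ∀ i, 0 < c i) (v : Fin (n + 1) → Fin n → K) :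
    negCount (fun k => c k • g.mulVec (v k)) = negCount v := by
  rw [negCount, negCount]
  congr 1
  ext i
  have h : 0 < (∏ k, c (i.succAbove k)) * g.det := mul_pos (Finset.prod_pos fun k _ => hc _) hg
  simp only [Finset.mem_filter, Finset.mem_univ, true_and, relCoeff_map_smul]
  rw [mul_neg_iff]
  simp [h, h.not_gt]

/-- The parity of the count is the sign of the product of all coefficients. -/
theorem neg_one_pow_negCount_mul_prod_pos {v : Fin (n + 1) → Fin n → K}
    (hv : ∀ i, relCoeff v i ≠ 0) : 0 < (-1) ^ negCount v * ∏ i, relCoeff v i := by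
  have h : (-1 : K) ^ negCount v = ∏ i, if relCoeff v i < 0 then -1 else 1 := by
    rw [Finset.prod_ite, Finset.prod_const, Finset.prod_const_one, mul_one, negCount]
  rw [h, ← Finset.prod_mul_distrib]
  refine Finset.prod_pos fun i _ => ?_
  rcases (hv i).lt_or_gt with h | h
  · simp [h]
  · simp [h.not_gt, h]

/-- The product of all coefficients is multiplied by `(∏ c) ^ n * g.det ^ (n + 1)`, which is
positive for even `n` even when some `c i` are negative. The parity, unlike the count itself, is
therefore defined for points of projective space. -/
theorem neg_one_pow_negCount_map_smul (hn : Even n) {g : Matrix (Fin n) (Fin n) K}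
    (hg : 0 < g.det) {c : Fin (n + 1) → K} (hc : ∀ i, c i ≠ 0) {v : Fin (n + 1) → Fin n → K}
    (hv : ∀ i, relCoeff v i ≠ 0) :
    (-1 : ℤ) ^ negCount (fun k => c k • g.mulVec (v k)) = (-1) ^ negCount v := by
  have hprod : ∏ i, relCoeff (fun k => c k • g.mulVec (v k)) i =
      (∏ i, c i) ^ n * g.det ^ (n + 1) * ∏ i, relCoeff v i := by
    simp only [relCoeff_map_smul, Finset.prod_mul_distrib, Finset.prod_const, Finset.card_univ,
      Fintype.card_fin]
    congr 2
    -- The `i`-th factor lacks exactly `c i`; one further factor `∏ c` supplies all the missing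
    -- scalars.
    have h0 : ∏ i, c i ≠ 0 := Finset.prod_ne_zero_iff.2 fun i _ => hc i
    apply mul_left_cancel₀ h0
    rw [← Finset.prod_mul_distrib, ← pow_succ']
    simp_rw [← Fin.prod_univ_succAbove c]
    simp
  have hne : ∀ i, relCoeff (fun k => c k • g.mulVec (v k)) i ≠ 0 := by
    intro i
    rw [relCoeff_map_smul]
    exact mul_ne_zero (mul_ne_zero (Finset.prod_ne_zero_iff.2 fun k _ => hc _) hg.ne') (hv i)
  have h1 := neg_one_pow_negCount_mul_prod_pos hne
  have h2 := neg_one_pow_negCount_mul_prod_pos hv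
  rw [hprod] at h1
  have h3 : 0 < (∏ i, c i) ^ n * g.det ^ (n + 1) :=
    mul_pos (hn.pow_pos (Finset.prod_ne_zero_iff.2 fun i _ => hc i)) (pow_pos hg _)
  rw [mul_left_comm] at h1
  have h4 := (pos_iff_pos_of_mul_pos h1).1 h3
  rcases neg_one_pow_eq_or ℤ (negCount fun k => c k • g.mulVec (v k)) with ha | ha <;>
    rcases neg_one_pow_eq_or ℤ (negCount v) with hb | hb
  · rw [ha, hb]
  · have ha' := congrArg (Int.cast : ℤ → K) ha
    have hb' := congrArg (Int.cast : ℤ → K) hb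
    push_cast at ha' hb'
    rw [ha'] at h4
    rw [hb'] at h2
    linarith
  · have ha' := congrArg (Int.cast : ℤ → K) ha
    have hb' := congrArg (Int.cast : ℤ → K) hb
    push_cast at ha' hb'
    rw [ha'] at h4
    rw [hb'] at h2
    linarith
  · rw [ha, hb]

/-- The sign change `α k ↦ -α k` in the relation makes positive entries count, so that the symbol
`a⁺` has count exactly `a`. -/
theorem negCount_standardTuple (hn : Even n) (α : Fin n → K) :
    negCount (standardTuple α) = (Finset.univ.filter fun k => 0 < α k).card := by
  have h : (Finset.univ.filter fun i => relCoeff (standardTuple α) i < 0) =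
      (Finset.univ.filter fun k => 0 < α k).map Fin.castSuccEmb := by
    ext i
    induction i using Fin.lastCases with
    | last =>
      simp [relCoeff_standardTuple_last hn, (zero_lt_one (α := K)).not_gt, Fin.castSucc_ne_last]
    | cast k => simp [relCoeff_standardTuple_castSucc hn]
  rw [negCount, h, Finset.card_map]

end Counting

/-! ### Sorting a subset by a permutation of prescribed sign -/

section Permutations

/-- Any bijection from an initial segment onto `N` extends to a permutation. As `N` has at most `n /
2` elements, the indices `n - 1` and `n` lie outside the segment, and swapping them corrects the
sign. -/
theorem exists_perm_mem_iff {n : ℕ} (hn : 2 ≤ n) (N : Finset (Fin (n + 1)))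
    (hN : N.card ≤ n / 2) (s : ℤˣ) : ∃ t : Equiv.Perm (Fin (n + 1)),
      Equiv.Perm.sign t = s ∧ ∀ i, t i ∈ N ↔ (i : ℕ) < N.card := by
  have hcard : Fintype.card {i : Fin (n + 1) // (i : ℕ) < N.card} =
      Fintype.card {i // i ∈ N} := by
    rw [Fintype.card_coe, Fintype.card_subtype, Fin.card_filter_val_lt]
    omega
  set t := (Fintype.equivOfCardEq hcard).extendSubtype with ht
  have hmem : ∀ i, t i ∈ N ↔ (i : ℕ) < N.card := fun i =>
    ⟨fun h => by_contra fun hi =>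
      (Fintype.equivOfCardEq hcard).extendSubtype_not_mem i hi h,
      fun h => (Fintype.equivOfCardEq hcard).extendSubtype_mem i h⟩
  by_cases hs : Equiv.Perm.sign t = s
  · exact ⟨t, hs, hmem⟩
  · set a : Fin (n + 1) := ⟨n - 1, by omega⟩
    set b : Fin (n + 1) := ⟨n, by omega⟩
    have hab : a ≠ b := by simp [a, b, Fin.ext_iff]; omega
    refine ⟨t * Equiv.swap a b, ?_, fun i => ?_⟩
    · rw [Equiv.Perm.sign_mul, Equiv.Perm.sign_swap hab]
      rcases Int.units_eq_one_or s with rfl | rfl <;>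
        rcases Int.units_eq_one_or (Equiv.Perm.sign t) with h | h <;> simp_all
    · rw [Equiv.Perm.mul_apply, hmem]
      by_cases ha : i = a
      · subst ha
        rw [Equiv.swap_apply_left]
        simp only [a, b]
        omega
      · by_cases hb : i = b
        · subst hb
          rw [Equiv.swap_apply_right]
          simp only [a, b]
          omega
        · rw [Equiv.swap_apply_of_ne_of_ne ha hb]

end Permutations

/-! ### Functionals on the coefficient groups and generation by the symbols -/

section Symbols

variable {K : Type u} [Field K] [LinearOrder K] [IsStrictOrderedRing K] {n : ℕ}

/-- A matrix of positive determinant as an element of `GL₊(n, K)`. -/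
noncomputable def glPosMk (g : Matrix (Fin n) (Fin n) K) (hg : 0 < g.det) :
    Matrix.GLPos (Fin n) K :=
  ⟨Matrix.GeneralLinearGroup.mkOfDetNeZero g hg.ne', hg⟩

/-- Positivity of the scalar, beyond its being non-zero, is what makes the count independent of the
chosen representatives of rays. -/
theorem exists_pos_rep_rayPoint (v : Fin n → K) (hv : v ≠ 0) :
    ∃ c : K, 0 < c ∧ (rayOfNeZero K v hv).someVector = c • v := by
  have h := (ray_eq_iff (rayOfNeZero K v hv).someVector_ne_zero hv).1
    (Module.Ray.someVector_ray _)
  obtain ⟨a, b, ha, hb, hab⟩ := h.exists_pos (Module.Ray.someVector_ne_zero _) hv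
  refine ⟨a⁻¹ * b, by positivity, ?_⟩
  rw [mul_smul, ← hab, smul_smul, inv_mul_cancel₀ ha.ne', one_smul]

theorem smul_rayOfNeZero (g : Matrix.GLPos (Fin n) K) (v : Fin n → K) (hv : v ≠ 0) :
    (QuotientGroup.mk g : PPlusGLPlus K n) • rayOfNeZero K v hv =
      rayOfNeZero K (g • v) ((smul_ne_zero_iff_ne g).2 hv) := rfl

theorem smul_projPoint_mk (g : Matrix.GLPos (Fin n) K) (v : Fin n → K) (hv : v ≠ 0) :
    (QuotientGroup.mk g : PGLPlus K n) • Projectivization.mk K v hv =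
      Projectivization.mk K (g • v) ((smul_ne_zero_iff_ne g).2 hv) := rfl

theorem rep_smul_rayPoint_pos (γ : PPlusGLPlus K n) :
    ∃ g : Matrix (Fin n) (Fin n) K, 0 < g.det ∧ ∀ p : RayPoint K n, ∃ c : K, 0 < c ∧
      (γ • p).someVector = c • g.mulVec p.someVector := by
  induction γ using QuotientGroup.induction_on with | H g =>
  refine ⟨((Matrix.GLPos (Fin n) K).subtype g : Matrix (Fin n) (Fin n) K), g.2, fun p => ?_⟩
  obtain ⟨c, hc, h⟩ := exists_pos_rep_rayPoint (g • p.someVector)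
    ((smul_ne_zero_iff_ne g).2 p.someVector_ne_zero)
  refine ⟨c, hc, ?_⟩
  rw [← smul_rayOfNeZero g _ p.someVector_ne_zero, p.someVector_ray] at h
  exact h

theorem rep_smul_projPoint_pos (γ : PGLPlus K n) :
    ∃ g : Matrix (Fin n) (Fin n) K, 0 < g.det ∧ ∀ p : ProjPoint K n, ∃ c : K, c ≠ 0 ∧
      (γ • p).rep = c • g.mulVec p.rep := by
  induction γ using QuotientGroup.induction_on with | H g =>
  refine ⟨((Matrix.GLPos (Fin n) K).subtype g : Matrix (Fin n) (Fin n) K), g.2, fun p => ?_⟩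
  obtain ⟨c, hc, h⟩ := rep_projPoint (g • p.rep) ((smul_ne_zero_iff_ne g).2 p.rep_nonzero)
  refine ⟨c, hc, ?_⟩
  rw [← smul_projPoint_mk g _ p.rep_nonzero, p.mk_rep] at h
  exact h

/-- The standard simplices of `X`. -/
noncomputable def projStandardSimplex (hn : 2 ≤ n) (α : Fin n → K) (hα : ∀ i, α i ≠ 0) :
    OrderedSimplex (projComplex K n) n :=
  standardSimplex hn _ _ _ (Projectivization.mk K) rep_projPoint α hα

/-- The standard simplices of `X₊`. -/
noncomputable def rayStandardSimplex (hn : 2 ≤ n) (α : Fin n → K) (hα : ∀ i, α i ≠ 0) :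
    OrderedSimplex (rayComplex K n) n :=
  standardSimplex hn _ _ _ (rayOfNeZero K) rep_rayPoint α hα

/-- The homomorphism `U₊ → ℤ` given by an antisymmetric function of the number of negative
coefficients. -/
noncomputable def rayFunctional (K : Type u) [Field K] [LinearOrder K] [IsStrictOrderedRing K]
    (w : ℕ → ℤ) (hw : ∀ k < n + 2, w (n + 1 - k) = -w k) : UPlus K n →ₗ[IntU.{u}] IntU.{u} :=
  countFunctional w hw fun γ σ => by
    obtain ⟨g, hg, h⟩ := rep_smul_rayPoint_pos γ
    choose c hc h using h
    simp only [h]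
    rw [negCount_map_pos_smul hg fun i => hc (σ.vertex i)]

theorem rayFunctional_simplexClass (w : ℕ → ℤ) (hw : ∀ k < n + 2, w (n + 1 - k) = -w k)
    (σ : OrderedSimplex (rayComplex K n) n) :
    rayFunctional K w hw (simplexClass IntU.{u} σ) =
      ((w (negCount fun k => (σ.vertex k).someVector) : ℤ) : IntU.{u}) :=
  countFunctional_simplexClass w hw _ σ

/-- Since `n + 1` is odd, `k` and `n + 1 - k` have opposite parities. -/
theorem neg_one_pow_antisymm (heven : Even n) : ∀ k < n + 2,
    (-1 : ℤ) ^ (n + 1 - k) = -(-1) ^ k := by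
  intro k hk
  have h : (-1 : ℤ) ^ (n + 1 - k) * (-1) ^ k = -1 := by
    rw [← pow_add, Nat.sub_add_cancel (by omega)]
    exact heven.add_one.neg_one_pow
  rcases neg_one_pow_eq_or ℤ k with hk | hk <;> rw [hk] at h ⊢ <;> linarith

/-- The orientation homomorphism `U → ℤ`. -/
noncomputable def projFunctional (K : Type u) [Field K] [LinearOrder K] [IsStrictOrderedRing K]
    (heven : Even n) : U K n →ₗ[IntU.{u}] IntU.{u} :=
  countFunctional (fun k => (-1) ^ k) (neg_one_pow_antisymm heven) fun γ σ => by
    obtain ⟨g, hg, h⟩ := rep_smul_projPoint_pos γ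
    choose c hc h using h
    simp only [h]
    rw [neg_one_pow_negCount_map_smul heven hg (fun i => hc (σ.vertex i))
      (relCoeff_vertex_ne_zero σ)]

theorem projFunctional_simplexClass (heven : Even n) (σ : OrderedSimplex (projComplex K n) n) :
    projFunctional K heven (simplexClass IntU.{u} σ) =
      (((-1) ^ negCount fun k => (σ.vertex k).rep : ℤ) : IntU.{u}) :=
  countFunctional_simplexClass _ _ _ σ

theorem rayFunctional_symbolPlus (hn : 2 ≤ n) (heven : Even n) (w : ℕ → ℤ)
    (hw : ∀ k < n + 2, w (n + 1 - k) = -w k) {a : ℕ} (ha : a ≤ n) :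
    rayFunctional K w hw (symbolPlus K hn a) = ((w a : ℤ) : IntU.{u}) := by
  refine (rayFunctional_simplexClass w hw _).trans ?_
  congr 2
  choose c hc h using exists_pos_rep_rayPoint (K := K) (n := n)
  set α : Fin n → K := fun i => if (i : ℕ) < a then 1 else -1
  have hα : ∀ i, α i ≠ 0 := fun i => by simp only [α]; split_ifs <;> simp
  -- The chosen representatives are positive multiples of the standard vectors: the invariance
  -- statement with the identity matrix.
  have h1 := negCount_map_pos_smul (g := (1 : Matrix (Fin n) (Fin n) K)) (by simp)
    (fun i => hc (standardTuple α i) (standardTuple_ne hn α hα i)) (standardTuple α)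
  simp only [Matrix.one_mulVec, ← h] at h1
  refine h1.trans ?_
  rw [negCount_standardTuple heven]
  have h2 : (Finset.univ.filter fun k : Fin n => 0 < α k) =
      Finset.univ.filter fun k : Fin n => (k : ℕ) < a := by
    ext k
    simp only [α, Finset.mem_filter, Finset.mem_univ, true_and]
    split_ifs with hk <;> simp [hk]
  rw [h2, Fin.card_filter_val_lt]
  omega

theorem projFunctional_symbolPos (hn : 2 ≤ n) (heven : Even n) :
    projFunctional K heven (symbolPos K hn) = 1 := by
  refine (projFunctional_simplexClass heven _).trans ?_
  choose c hc h using rep_projPoint (K := K) (n := n)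
  set α : Fin n → K := fun _ => 1
  have hα : ∀ i, α i ≠ 0 := fun i => one_ne_zero
  have hne : ∀ i, relCoeff (standardTuple α) i ≠ 0 := by
    intro i
    induction i using Fin.lastCases with
    | last => simp [relCoeff_standardTuple_last heven]
    | cast k => simp [relCoeff_standardTuple_castSucc heven, α]
  have h1 := neg_one_pow_negCount_map_smul heven (g := (1 : Matrix (Fin n) (Fin n) K)) (by simp)
    (fun i => hc (standardTuple α i) (standardTuple_ne hn α hα i)) hne
  simp only [Matrix.one_mulVec, ← h] at h1
  refine (congrArg Int.cast h1).trans ?_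
  rw [negCount_standardTuple heven]
  simp [α, heven.neg_one_pow]

/-- Once the negative coefficients come first and number at most `n / 2`, the matrix carrying the
standard tuple to the given one has positive determinant and rescales every vector positively, so
the simplex is a translate of a standard one. -/
theorem exists_simplexClass_eq_symbolPlus (hn : 2 ≤ n) (heven : Even n)
    (σ : OrderedSimplex (rayComplex K n) n) :
    ∃ a ≤ n / 2, ∃ c : IntU.{u}, simplexClass IntU.{u} σ = c • symbolPlus K hn a := by
  set v : Fin (n + 1) → Fin n → K := fun k => (σ.vertex k).someVector with hv
  have hne : ∀ i, relCoeff v i ≠ 0 := relCoeff_vertex_ne_zero σ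
  obtain ⟨t, a, ha, ht⟩ : ∃ t : Equiv.Perm (Fin (n + 1)), ∃ a ≤ n / 2,
      ∀ i, relCoeff (v ∘ t) i < 0 ↔ (i : ℕ) < a := by
    -- Because `n + 1` is odd, either the negative or the positive coefficients number at most `n /
    -- 2`. In the second case an odd permutation makes the positive ones negative.
    by_cases hq : negCount v ≤ n / 2
    · obtain ⟨t, hs, ht⟩ := exists_perm_mem_iff hn _ hq 1
      exact ⟨t, _, hq, fun i => by rw [negCount, ← ht i, relCoeff_permute, hs]; simp⟩
    · have hp : (Finset.univ.filter fun i => 0 < relCoeff v i).card ≤ n / 2 := by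
        rw [card_relCoeff_pos hne]
        obtain ⟨m, rfl⟩ := heven
        omega
      obtain ⟨t, hs, ht⟩ := exists_perm_mem_iff hn _ hp (-1)
      exact ⟨t, _, hp, fun i => by rw [← ht i, relCoeff_permute, hs]; simp⟩
  have hne' : ∀ i, relCoeff (v ∘ t) i ≠ 0 := relCoeff_vertex_ne_zero (σ.permute t)
  refine ⟨a, ha, (Equiv.Perm.sign t : ℤ), ?_⟩
  refine (simplexClass_eq_permute σ t).trans (congrArg _ ?_)
  have hα : ∀ k : Fin n, (fun i : Fin n => if (i : ℕ) < a then (1 : K) else -1) k ≠ 0 :=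
    fun k => by dsimp only; split_ifs <;> simp
  obtain ⟨g, hdet, hg, hlast⟩ := exists_mulVec_standardTuple heven (v ∘ t) hα
  have hβ : ∀ k : Fin n,
      0 < -relCoeff (v ∘ t) k.castSucc / (if (k : ℕ) < a then (1 : K) else -1) := by
    intro k
    split_ifs with hk
    · simpa using (ht k.castSucc).2 hk
    · have h := (hne' k.castSucc).lt_or_gt.resolve_left fun h => hk ((ht k.castSucc).1 h)
      simpa using h
  -- The last index is not among the first `a`, since `a ≤ n / 2 < n`.
  have hβlast : 0 < relCoeff (v ∘ t) (Fin.last n) :=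
    (hne' _).lt_or_gt.resolve_left fun h => by
      have := (ht _).1 h
      simp at this
      omega
  have hpos : 0 < g.det := by
    rw [hdet]
    exact mul_pos (Finset.prod_pos fun k _ => hβ k) hβlast
  refine Eq.trans ?_ (simplexClass_translate (QuotientGroup.mk (glPosMk g hpos) : PPlusGLPlus K n)
    (rayStandardSimplex hn _ hα))
  congr 1
  ext i
  rw [OrderedSimplex.translate_vertex]
  refine Eq.trans ?_ (smul_rayOfNeZero (glPosMk g hpos) _ (standardTuple_ne hn _ hα i)).symm
  rw [OrderedSimplex.permute_vertex, ← Module.Ray.someVector_ray (σ.vertex (t i)), ray_eq_iff]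
  change SameRay K (v (t i)) (g.mulVec (standardTuple _ i))
  induction i using Fin.lastCases with
  | last =>
    rw [hlast]
    exact SameRay.sameRay_pos_smul_right _ hβlast
  | cast k =>
    rw [hg]
    exact SameRay.sameRay_pos_smul_right _ (hβ k)

/-- In projective space the signs of individual scalings are irrelevant; only `g.det` must be
positive. For `α = 1` and even `n` it equals the product of all coefficients. -/
theorem exists_simplexClass_eq_symbolPos (hn : 2 ≤ n) (heven : Even n)
    (σ : OrderedSimplex (projComplex K n) n) :
    ∃ c : IntU.{u}, simplexClass IntU.{u} σ = c • symbolPos K hn := by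
  set v : Fin (n + 1) → Fin n → K := fun k => (σ.vertex k).rep with hv
  have hne : ∀ i, relCoeff v i ≠ 0 := relCoeff_vertex_ne_zero σ
  obtain ⟨t, ht⟩ : ∃ t : Equiv.Perm (Fin (n + 1)), 0 < ∏ i, relCoeff (v ∘ t) i := by
    rcases (Finset.prod_ne_zero_iff.2 fun i _ => hne i : ∏ i, relCoeff v i ≠ 0).lt_or_gt with h | h
    · have h01 : (0 : Fin (n + 1)) ≠ Fin.last n := by simp [Fin.ext_iff]; omega
      -- A transposition negates each of the `n + 1` coefficients, an odd number, and hence their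
      -- product.
      refine ⟨Equiv.swap 0 (Fin.last n), ?_⟩
      simp only [relCoeff_permute, Equiv.Perm.sign_swap h01, Finset.prod_mul_distrib,
        Equiv.prod_comp, Finset.prod_const, Finset.card_univ, Fintype.card_fin]
      have : (-1 : K) ^ (n + 1) = -1 := heven.add_one.neg_one_pow
      simpa [this] using h
    · exact ⟨1, h⟩
  have hne' : ∀ i, relCoeff (v ∘ t) i ≠ 0 := relCoeff_vertex_ne_zero (σ.permute t)
  refine ⟨(Equiv.Perm.sign t : ℤ), ?_⟩
  refine (simplexClass_eq_permute σ t).trans (congrArg _ ?_)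
  have hα : ∀ k : Fin n, (fun _ : Fin n => (1 : K)) k ≠ 0 := fun k => one_ne_zero
  obtain ⟨g, hdet, hg, hlast⟩ := exists_mulVec_standardTuple heven (v ∘ t) hα
  have hpos : 0 < g.det := by
    rw [hdet]
    rw [Fin.prod_univ_castSucc] at ht
    simpa [Finset.prod_neg, heven.neg_one_pow] using ht
  refine Eq.trans ?_ (simplexClass_translate (QuotientGroup.mk (glPosMk g hpos) : PGLPlus K n)
    (projStandardSimplex hn _ hα))
  congr 1
  ext i
  rw [OrderedSimplex.translate_vertex]
  refine Eq.trans ?_ (smul_projPoint_mk (glPosMk g hpos) _ (standardTuple_ne hn _ hα i)).symm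
  rw [OrderedSimplex.permute_vertex, ← Projectivization.mk_rep (σ.vertex (t i)),
    Projectivization.mk_eq_mk_iff']
  change ∃ c : K, c • g.mulVec (standardTuple _ i) = v (t i)
  induction i using Fin.lastCases with
  | last =>
    rw [hlast]
    refine ⟨(relCoeff (v ∘ t) (Fin.last n))⁻¹, ?_⟩
    rw [smul_smul, inv_mul_cancel₀ (hne' _), one_smul]
    rfl
  | cast k =>
    rw [hg]
    refine ⟨(-relCoeff (v ∘ t) k.castSucc / 1)⁻¹, ?_⟩
    rw [smul_smul, inv_mul_cancel₀ (by simpa using hne' _), one_smul]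
    rfl

end Symbols

/-! ### The isomorphism of `U` with the integers and the basis of `U₊` -/

section Bases

variable {K : Type u} [Field K] [LinearOrder K] [IsStrictOrderedRing K] {n : ℕ}

/-- The orientation isomorphism `U ≃ ℤ`. -/
noncomputable def projEquiv (K : Type u) [Field K] [LinearOrder K] [IsStrictOrderedRing K]
    (hn : 2 ≤ n) (heven : Even n) : U K n ≃ₗ[IntU.{u}] IntU.{u} :=
  LinearEquiv.ofLinearMap (projFunctional K heven)
    (LinearMap.toSpanSingleton IntU.{u} (U K n) (symbolPos K hn))
    (LinearMap.ext_ring (by simp [projFunctional_symbolPos]))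
    (LinearMap.ext_on span_simplexClass (by
      rintro _ ⟨σ, rfl⟩
      obtain ⟨c, hc⟩ := exists_simplexClass_eq_symbolPos hn heven σ
      simp [hc, projFunctional_symbolPos]))

/-- The antisymmetric function `δ_a - δ_{n + 1 - a}`. -/
def coordCount (n a k : ℕ) : ℤ := (if k = a then 1 else 0) - if k + a = n + 1 then 1 else 0

theorem coordCount_antisymm (n a : ℕ) : ∀ k < n + 2,
    coordCount n a (n + 1 - k) = -coordCount n a k := by
  intro k hk
  have h1 : n + 1 - k = a ↔ k + a = n + 1 := by omega
  have h2 : n + 1 - k + a = n + 1 ↔ k = a := by omega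
  simp only [coordCount, h1, h2]
  ring

/-- In this range `k + a ≤ n`, so the reflected delta never fires; the count functionals are
therefore dual to the symbols. -/
theorem coordCount_of_le {a k : ℕ} (ha : a ≤ n / 2) (hk : k ≤ n / 2) :
    coordCount n a k = if k = a then 1 else 0 := by
  rw [coordCount, if_neg (show k + a ≠ n + 1 by omega), sub_zero]

/-- Both sides are antisymmetric under `k ↦ n + 1 - k`, and one of the two arguments is at most `n /
2`, where only the term `a = k` survives. This is the numerical identity behind the formula for the
Euler classes. -/
theorem sum_neg_one_pow_coordCount (heven : Even n) {k : ℕ} (hk : k < n + 2) :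
    ∑ a : Fin (n / 2 + 1), (-1 : ℤ) ^ (a : ℕ) * coordCount n a k = (-1) ^ k := by
  have key : ∀ k ≤ n / 2,
      ∑ a : Fin (n / 2 + 1), (-1 : ℤ) ^ (a : ℕ) * coordCount n a k = (-1) ^ k := by
    intro k hk
    rw [Finset.sum_eq_single ⟨k, by omega⟩]
    · simp [coordCount_of_le hk hk]
    · intro a _ ha
      rw [coordCount_of_le (by omega) hk, if_neg fun h => ha (Fin.ext h.symm), mul_zero]
    · simp
  by_cases h : k ≤ n / 2
  · exact key k h
  · have h2 : n + 1 - k ≤ n / 2 := by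
      obtain ⟨m, rfl⟩ := heven
      omega
    have h3 := key _ h2
    rw [neg_one_pow_antisymm heven k hk] at h3
    simp only [coordCount_antisymm n _ k hk, mul_neg, Finset.sum_neg_distrib] at h3
    exact neg_inj.1 h3

theorem linearIndependent_symbolPlus (hn : 2 ≤ n) (heven : Even n) :
    LinearIndependent IntU.{u} fun a : Fin (n / 2 + 1) => symbolPlus K hn a := by
  rw [Fintype.linearIndependent_iff]
  intro g hg a
  have h := congrArg (rayFunctional K (coordCount n a) (coordCount_antisymm n a)) hg
  rw [map_sum, map_zero, Finset.sum_eq_single a] at h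
  · rw [map_smul, rayFunctional_symbolPlus hn heven _ _ (by omega),
      coordCount_of_le (by omega) (by omega)] at h
    simpa using h
  · intro b _ hb
    rw [map_smul, rayFunctional_symbolPlus hn heven _ _ (by omega),
      coordCount_of_le (by omega) (by omega), if_neg fun h => hb (Fin.ext h)]
    simp
  · simp

theorem span_symbolPlus (hn : 2 ≤ n) (heven : Even n) :
    ⊤ ≤ Submodule.span IntU.{u} (Set.range fun a : Fin (n / 2 + 1) => symbolPlus K hn a) := by
  refine span_simplexClass.ge.trans (Submodule.span_le.2 ?_)
  rintro _ ⟨σ, rfl⟩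
  obtain ⟨a, ha, c, hc⟩ := exists_simplexClass_eq_symbolPlus hn heven σ
  rw [hc]
  exact Submodule.smul_mem _ _ (Submodule.subset_span ⟨⟨a, by omega⟩, rfl⟩)

/-- The basis of `U₊` consisting of the symbols `a⁺`. -/
noncomputable def rayBasis (K : Type u) [Field K] [LinearOrder K] [IsStrictOrderedRing K]
    (hn : 2 ≤ n) (heven : Even n) :
    Module.Basis (Fin (n / 2 + 1)) IntU.{u} (UPlus K n) :=
  Module.Basis.mk (linearIndependent_symbolPlus hn heven) (span_symbolPlus hn heven)

theorem rayBasis_apply (hn : 2 ≤ n) (heven : Even n) (a : Fin (n / 2 + 1)) :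
    rayBasis K hn heven a = symbolPlus K hn a :=
  Module.Basis.mk_apply _ _ a

/-- Agreement on the basis makes the abstract coordinates explicit, so they can be evaluated on
every simplex through its count. -/
theorem rayBasis_coord (hn : 2 ≤ n) (heven : Even n) (a : Fin (n / 2 + 1)) :
    (rayBasis K hn heven).coord a =
      rayFunctional K (coordCount n a) (coordCount_antisymm n a) := by
  refine (rayBasis K hn heven).ext fun b => ?_
  rw [Module.Basis.coord_apply, Module.Basis.repr_self, rayBasis_apply,
    rayFunctional_symbolPlus hn heven _ _ (by omega), coordCount_of_le (by omega) (by omega),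
    Finsupp.single_apply]
  simp only [Fin.ext_iff]
  split_ifs <;> simp

end Bases

/-! ### The chain map from rays to points -/

section RaysToPoints

variable {K : Type u} [Field K] [LinearOrder K] [IsStrictOrderedRing K] {n : ℕ}

/-- The projection from rays to points of projective space. -/
noncomputable def rayToPoint (p : RayPoint K n) : ProjPoint K n :=
  Projectivization.mk K p.someVector p.someVector_ne_zero

theorem rayToPoint_rayOfNeZero (v : Fin n → K) (hv : v ≠ 0) :
    rayToPoint (rayOfNeZero K v hv) = Projectivization.mk K v hv := by
  obtain ⟨c, -, hc⟩ := exists_pos_rep_rayPoint v hv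
  rw [rayToPoint, Projectivization.mk_eq_mk_iff']
  exact ⟨c, hc.symm⟩

theorem rayToPoint_smul (γ : PPlusGLPlus K n) (p : RayPoint K n) :
    rayToPoint (γ • p) = projection K n γ • rayToPoint p := by
  induction γ using QuotientGroup.induction_on with | H g =>
  induction p using Module.Ray.ind with | _ v hv =>
  rw [smul_rayOfNeZero, rayToPoint_rayOfNeZero, rayToPoint_rayOfNeZero]
  rfl

theorem isGeneric_image_rayToPoint {s : Finset (RayPoint K n)}
    (hs : IsGeneric (fun p : RayPoint K n => p.someVector) s) {t : Finset (RayPoint K n)}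
    (ht : t ⊆ s) (hcard : t.card ≤ n) :
    LinearIndepOn K (fun p : RayPoint K n => (rayToPoint p).rep) (t : Set (RayPoint K n)) :=
  linearIndepOn_rescale (LinearEquiv.refl K _) (fun p => rep_projPoint _ p.someVector_ne_zero)
    (hs t ht hcard)

/-- The image in `X` of a simplex of `X₊`. -/
noncomputable def pointSimplex (hn : 2 ≤ n) {d : ℕ} (σ : OrderedSimplex (rayComplex K n) d) :
    OrderedSimplex (projComplex K n) d where
  -- Opposite rays have the same image, but they cannot both be vertices: as `2 ≤ n`, genericity
  -- makes any two vertices independent.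
  vertex := ⟨fun i => rayToPoint (σ.vertex i), fun i j hij => by
    classical
    have h := isGeneric_image_rayToPoint σ.mem_faces.2 (t := {σ.vertex i, σ.vertex j})
      (by intro p; simp only [Finset.mem_insert, Finset.mem_singleton, Finset.mem_map,
        Finset.mem_univ, true_and]; rintro (rfl | rfl) <;> exact ⟨_, rfl⟩)
      (Finset.card_le_two.trans hn)
    exact σ.vertex.injective (h.injOn (by simp) (by simp)
      (congrArg (fun p : ProjPoint K n => p.rep) hij))⟩
  mem_faces := by
    refine ⟨by simp, fun t ht hcard => ?_⟩
    obtain ⟨t', -, rfl⟩ := Finset.subset_map_iff.1 ht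
    rw [Finset.card_map] at hcard
    have h := isGeneric_image_rayToPoint σ.mem_faces.2 (t := t'.map σ.vertex)
      (Finset.map_subset_map.2 (Finset.subset_univ _)) (by simpa using hcard)
    rw [Finset.coe_map] at h ⊢
    exact LinearIndepOn.image_of_comp (f := fun i => rayToPoint (σ.vertex i))
      (g := fun p : ProjPoint K n => p.rep) (h.comp_of_image σ.vertex.injective.injOn)

theorem pointSimplex_translate (hn : 2 ≤ n) {d : ℕ} (γ : PPlusGLPlus K n)
    (σ : OrderedSimplex (rayComplex K n) d) :
    pointSimplex hn (σ.translate γ) = (pointSimplex hn σ).translate (projection K n γ) :=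
  OrderedSimplex.ext' fun i => rayToPoint_smul γ (σ.vertex i)

/-- The chain map induced by the projection from rays to points, in one degree. -/
noncomputable def pointChain (K : Type u) [Field K] [LinearOrder K] [IsStrictOrderedRing K]
    (hn : 2 ≤ n) (d : ℕ) :
    Chain IntU.{u} (rayComplex K n) d →ₗ[IntU.{u}] Chain IntU.{u} (projComplex K n) d :=
  chainLift (fun σ => chainOf IntU.{u} (pointSimplex hn σ)) fun σ t =>
    chainOf_permute (pointSimplex hn σ) t

theorem pointChain_chainOf (hn : 2 ≤ n) {d : ℕ} (σ : OrderedSimplex (rayComplex K n) d) :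
    pointChain K hn d (chainOf IntU.{u} σ) = chainOf IntU.{u} (pointSimplex hn σ) :=
  chainLift_chainOf _ _ _

/-- The chain map `C_* X₊ → C_* X`, equivariant along the natural projection of groups. -/
noncomputable def pointChainMap (K : Type u) [Field K] [LinearOrder K] [IsStrictOrderedRing K]
    (hn : 2 ≤ n) :
    (rayResolution K hn).complex ⟶ ((projResolution K hn).restrict (projection K n)).complex where
  f d := Rep.ofHom (ρ := chainAction IntU.{u} (rayComplex K n) d)
    (σ := (chainAction IntU.{u} (projComplex K n) d).comp (projection K n))
    ⟨pointChain K hn d, fun γ => chain_hom_ext fun σ => by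
      rw [LinearMap.comp_apply, LinearMap.comp_apply, chainAction_chainOf, pointChain_chainOf,
        pointChain_chainOf, pointSimplex_translate]
      exact (chainAction_chainOf _ _).symm⟩
  comm' := by
    rintro i j (rfl : j + 1 = i)
    refine Rep.hom_ext (Representation.IntertwiningMap.ext ?_)
    have h : boundary IntU.{u} (projComplex K n) j ∘ₗ pointChain K hn (j + 1) =
        pointChain K hn j ∘ₗ boundary IntU.{u} (rayComplex K n) j :=
      chain_hom_ext fun σ => by
        simp only [LinearMap.comp_apply, pointChain_chainOf, boundary_chainOf, map_sum, map_smul]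
        rfl
    have h1 := chainComplex_d (R := IntU.{u}) (X := rayComplex K n) j
    have h2 := chainComplex_d (R := IntU.{u}) (X := projComplex K n) j
    change ((chainComplex IntU.{u} (projComplex K n)).d (j + 1) j).hom.toLinearMap ∘ₗ
        pointChain K hn (j + 1) =
      pointChain K hn j ∘ₗ ((chainComplex IntU.{u} (rayComplex K n)).d (j + 1) j).hom.toLinearMap
    rw [h1, h2]
    exact h

theorem pointChainMap_aug (hn : 2 ≤ n) :
    (pointChainMap K hn).f 0 ≫ ((projResolution K hn).restrict (projection K n)).aug =
      (rayResolution K hn).aug := by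
  refine Rep.hom_ext (Representation.IntertwiningMap.ext ?_)
  refine chain_hom_ext (f := augmentation IntU.{u} (projComplex K n) ∘ₗ pointChain K hn 0)
    (g := augmentation IntU.{u} (rayComplex K n)) fun σ => ?_
  rw [LinearMap.comp_apply, pointChain_chainOf, augmentation_chainOf, augmentation_chainOf]

/-- Passing to points may change the signs of the representatives, but not the parity of the count,
and the parity is the alternating sum of the coordinate counts. This is the theorem at the level of
cocycles. -/
theorem projFunctional_pointSimplex (hn : 2 ≤ n) (heven : Even n)
    (σ : OrderedSimplex (rayComplex K n) n) :
    projFunctional K heven (simplexClass IntU.{u} (pointSimplex hn σ)) =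
      (∑ a : Fin (n / 2 + 1), (-1 : ℤ) ^ (a : ℕ) • (rayBasis K hn heven).coord a)
        (simplexClass IntU.{u} σ) := by
  rw [projFunctional_simplexClass, LinearMap.sum_apply]
  simp only [rayBasis_coord, LinearMap.smul_apply, rayFunctional_simplexClass]
  have hq : negCount (fun k => (σ.vertex k).someVector) < n + 2 := by
    have := negCount_le fun k => (σ.vertex k).someVector
    omega
  have h1 : (-1 : ℤ) ^ (negCount fun k => ((pointSimplex hn σ).vertex k).rep) =
      (-1) ^ negCount fun k => (σ.vertex k).someVector := by
    choose c hc h using fun p : RayPoint K n => rep_projPoint p.someVector p.someVector_ne_zero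
    have := neg_one_pow_negCount_map_smul heven (g := (1 : Matrix (Fin n) (Fin n) K)) (by simp)
      (fun i => hc (σ.vertex i)) (relCoeff_vertex_ne_zero σ)
    simp only [Matrix.one_mulVec, ← h] at this
    exact this
  rw [h1, ← sum_neg_one_pow_coordCount heven hq]
  push_cast
  simp [zsmul_eq_mul]

end RaysToPoints

end TautologicalClass

/-! ### The relation between the Euler classes -/

open TautologicalClass
theorem theorem13p1 {K : Type u} [Field K] [LinearOrder K] [IsStrictOrderedRing K]
    {n : ℕ} (hn : 2 ≤ n) (heven : Even n) :
    ∃ (e : U K n ≃ₗ[IntU.{u}] IntU.{u})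
      (b : Module.Basis (Fin (n / 2 + 1)) IntU.{u} (UPlus K n)),
      e (symbolPos K hn) = 1 ∧ (∀ a : Fin (n / 2 + 1), b a = symbolPlus K hn a) ∧
      pullback (projection K n) IntU.{u} n (coeffMap e.toLinearMap n (eu K hn)) =
        ∑ a : Fin (n / 2 + 1), (-1 : ℤ) ^ (a : ℕ) • coeffMap (b.coord a) n (euPlus K hn) := by
  refine ⟨projEquiv K hn heven, rayBasis K hn heven, projFunctional_symbolPos hn heven,
    rayBasis_apply hn heven, ?_⟩
  rw [coeffMap_sum]
  set f := ∑ a : Fin (n / 2 + 1), (-1 : ℤ) ^ (a : ℕ) • (rayBasis K hn heven).coord a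
  have h1 := coeffMap_tautologicalClass (projResolution K hn) n
    (projEquiv K hn heven).toLinearMap
  have h2 := coeffMap_tautologicalClass (rayResolution K hn) n f
  -- The two cocycles agree exactly on `C_n X₊`, with no coboundary correction, so naturality alone
  -- finishes the argument.
  have hST : ∀ x, (coeffCocycle (rayResolution K hn).complex n f).hom x =
      (coeffCocycle (projResolution K hn).complex n (projEquiv K hn heven).toLinearMap).hom
        (((pointChainMap K hn).f n).hom x) := by
    refine LinearMap.congr_fun (f := f ∘ₗ toCoeff (chainComplex IntU.{u} (rayComplex K n)) n)
      (g := (projFunctional K heven ∘ₗ toCoeff (chainComplex IntU.{u} (projComplex K n)) n) ∘ₗ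
        pointChain K hn n) ?_
    refine chain_hom_ext fun σ => ?_
    refine (projFunctional_pointSimplex hn heven σ).symm.trans ?_
    exact congrArg (fun c => projFunctional K heven
      (toCoeff (chainComplex IntU.{u} (projComplex K n)) n c)) (pointChain_chainOf hn σ).symm
  refine (congrArg _ h1).trans (Eq.trans ?_ h2.symm)
  clear h1 h2
  -- Naturality is available in positive degrees, where the homotopy supplies a cochain one degree
  -- lower.
  obtain ⟨d, rfl⟩ : ∃ d, n = d + 1 := ⟨n - 1, by omega⟩
  exact pullback_classOfCocycle (projection K (d + 1)) (rayResolution K hn) (projResolution K hn)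
    (pointChainMap K hn) (pointChainMap_aug hn) _ _ _ _ hST
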